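/- **Setting.** Let $K\ge 2$ and $\Delta_K=\{p\in\mathbb R_{\ge 0}^K:\sum_i p_i=1\}$. A bandit model assigns to each parameter $\vartheta$ in a parameter set $\mathcal S$ and each arm $i\in[K]$ a reward distribution $P_{\vartheta,i}$ on $\mathbb R$ with mean $m_i(\vartheta)$. We consider two models. 1. *Unstructured, one-parameter exponential family.* Let $\nu$ be a measure on $\mathbb R$, let $N$ be the interior of $\{\eta:\int e^{\eta y}\,d\nu(y)<\infty\}$, and for $\eta\in N$ let $P^\eta$ be the probability measure with $\nu$-density proportional to $e^{\eta y}$. Parameterize the family $\{P^\eta:\eta\in N\}$ by its means, let $\mathcal M$ be the set of these means, $\mathcal S=\mathcal M^K$, and let $P_{\vartheta,i}$ be the member with mean $\vartheta_i$. 2. *Gaussian linear.* $\mathcal S=\mathbb R^d$ and $P_{\vartheta,i}=\mathcal N(a_i^\top\vartheta,\sigma_i^2)$ with arbitrary feature vectors $a_1,\dots,a_K\in\mathbb R^d$ and variances $\sigma_i^2>0$. Fix $\theta\in\mathcal S$ with a unique best arm $I^*$, i.e. $m_j(\theta)<m_{I^*}(\theta)$ for all $j\ne I^*$. Put $\mathcal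 X=[K]\setminus\{I^*\}$, let $\Delta_{|\mathcal X|}$ be the simplex of probability vectors on $\mathcal X$, and for $p\in\mathbb R^K_{\ge0}$, $x\in\mathcal X$, $\mu\in\Delta_{|\mathcal X|}$ put $$D(p,x)=\inf\Bigl\{\sum_{i=1}^K p_i\,\mathrm{KL}(P_{\theta,i}\,\|\,P_{\vartheta,i}) : \vartheta\in\mathcal S,\ m_{I^*}(\vartheta)<m_x(\vartheta)\Bigr\},\qquad F(p,\mu)=\sum_{x\in\mathcal X}\mu_x D(p,x).$$ A pair $(p^*,\mu^*)\in\Delta_K\times\Delta_{|\mathcal X|}$ is a Nash equilibrium if $F(p,\mu^*)\le F(p^*,\mu^*)\le F(p^*,\mu)$ for all $p\in\Delta_K$, $\mu\in\Delta_{|\mathcal X|}$. Let $\mathcal D_F$ be the set of $(p,\mu)\in\Delta_K\times\Delta_{|\mathcal X|}$ at which $F(\cdot,\mu)$ is differentiable at $p$ relative to $\mathbb R_{\ge0}^K$, with gradient $\nabla_pF(p,\mu)$. The Clarke generalized gradient is $$\partial_p^\circ F(p,\mu)=\mathrm{conv}\Bigl\{\lim_{n\to\infty}\nabla_pF(p^n,\mu^n)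 : \mathcal D_F\ni(p^n,\mu^n)\to(p,\mu)\Bigr\},$$ and the linear oracles are $$\mathrm{LMO}_p(p,\mu)=\mathrm{conv}\Bigl\{q\in\Delta_K:\exists f\in\partial_p^\circ F(p,\mu),\ q\in\operatorname*{argmax}_{q'\in\Delta_K}q'^\top f\Bigr\},\qquad \mathrm{LMO}_\mu(p,\mu)=\operatorname*{argmin}_{\nu\in\Delta_{|\mathcal X|}}\nu^\top\nabla_\mu F(p,\mu).$$ A sequence $(p_n,\mu_n)_{n\ge0}$ is generated by Frank–Wolfe self-play (FWSP) if $(p_0,\mu_0)\in\Delta_K\times\Delta_{|\mathcal X|}$ and, for all $n\ge0$, $$p_{n+1}=p_n+\tfrac1{n+1}(q_n-p_n),\quad \mu_{n+1}=\mu_n+\tfrac1{n+1}(\nu_n-\mu_n)\quad\text{for some } q_n\in\mathrm{LMO}_p(p_n,\mu_n),\ \nu_n\in\mathrm{LMO}_\mu(p_n,\mu_n)$$ (in particular, one-hot choices of $q_n,\nu_n$ with arbitrary tie-breaking are allowed). **Theorem.** In both models the game has an optimal value $F^*$, that is, a Nash equilibrium exists and $F$ takes the same value $F^*$ at all Nash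 equilibria; and every sequence generated by FWSP, from any initial point in $\Delta_K\times\Delta_{|\mathcal X|}$, satisfies $$\lim_{n\to\infty}F(p_n,\mu_n)=F^*.$$ -/

import Mathlib

open MeasureTheory ProbabilityTheory Filter Topology
open scoped NNReal ENNReal Matrix

noncomputable section

namespace FWSP

/-! ### Zero-sum games on a product of simplices and Frank–Wolfe self-play

`F p μ` is the payoff; the first player maximizes over `p` in the simplex over `ι`, the second
minimizes over `μ` in the simplex over `X`. The payoff is meaningful for all `p` in the nonnegative
orthant, and gradients in `p` are taken there. -/

section Game

variable {ι X : Type*} [Fintype ι] [Fintype X]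

/-- `F (·, μ)` is differentiable at `p` relative to the nonnegative orthant `Set.Ici 0`
(at points with positive coordinates this is ordinary differentiability). -/
def DifferentiableInP (F : (ι → ℝ) → (X → ℝ) → ℝ) (p : ι → ℝ) (μ : X → ℝ) : Prop :=
  DifferentiableWithinAt ℝ (fun p' => F p' μ) (Set.Ici 0) p

open Classical in
/-- The gradient `∇_p F (p, μ)`, relative to the nonnegative orthant. -/
def gradP (F : (ι → ℝ) → (X → ℝ) → ℝ) (p : ι → ℝ) (μ : X → ℝ) : ι → ℝ :=
  fun i => fderivWithin ℝ (fun p' => F p' μ) (Set.Ici 0) p (Pi.single i 1)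

open Classical in
/-- The gradient `∇_μ F (p, μ)`. -/
def gradMu (F : (ι → ℝ) → (X → ℝ) → ℝ) (p : ι → ℝ) (μ : X → ℝ) : X → ℝ :=
  fun x => fderiv ℝ (fun μ' => F p μ') μ (Pi.single x 1)

/-- The Clarke generalized gradient of `F` in `p`: the convex hull of all limits of gradients
`∇_p F` along sequences of points of differentiability in the product of the simplices that
converge to `(p, μ)`. Where `∇_p F` exists and is continuous this is the singleton of the
classical gradient; where it merely exists, it belongs to this set. -/
def clarkeGrad (F : (ι → ℝ) → (X → ℝ) → ℝ) (p : ι → ℝ) (μ : X → ℝ) : Set (ι → ℝ) :=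
  convexHull ℝ {f | ∃ (ps : ℕ → ι → ℝ) (μs : ℕ → X → ℝ),
    (∀ n, ps n ∈ stdSimplex ℝ ι ∧ μs n ∈ stdSimplex ℝ X ∧ DifferentiableInP F (ps n) (μs n)) ∧
    Tendsto ps atTop (𝓝 p) ∧ Tendsto μs atTop (𝓝 μ) ∧
    Tendsto (fun n => gradP F (ps n) (μs n)) atTop (𝓝 f)}

/-- The linear oracle of the maximizing player. -/
def lmoP (F : (ι → ℝ) → (X → ℝ) → ℝ) (p : ι → ℝ) (μ : X → ℝ) : Set (ι → ℝ) :=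
  convexHull ℝ {q | q ∈ stdSimplex ℝ ι ∧
    ∃ f ∈ clarkeGrad F p μ, ∀ q' ∈ stdSimplex ℝ ι, q' ⬝ᵥ f ≤ q ⬝ᵥ f}

/-- The linear oracle of the minimizing player. -/
def lmoMu (F : (ι → ℝ) → (X → ℝ) → ℝ) (p : ι → ℝ) (μ : X → ℝ) : Set (X → ℝ) :=
  {ν | ν ∈ stdSimplex ℝ X ∧
    ∀ ν' ∈ stdSimplex ℝ X, ν ⬝ᵥ gradMu F p μ ≤ ν' ⬝ᵥ gradMu F p μ}

/-- `(p n, μ n)` is a trajectory of discrete-time Frank–Wolfe self-play with step sizes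
`1 / (n + 1)`, started anywhere in the product of the simplices, with arbitrary choices from
the oracles. -/
structure IsTrajectory (F : (ι → ℝ) → (X → ℝ) → ℝ) (p : ℕ → ι → ℝ) (μ : ℕ → X → ℝ) :
    Prop where
  init_p : p 0 ∈ stdSimplex ℝ ι
  init_mu : μ 0 ∈ stdSimplex ℝ X
  step_p : ∀ n : ℕ, ∃ q ∈ lmoP F (p n) (μ n),
    p (n + 1) = p n + (1 / ((n : ℝ) + 1)) • (q - p n)
  step_mu : ∀ n : ℕ, ∃ ν ∈ lmoMu F (p n) (μ n),
    μ (n + 1) = μ n + (1 / ((n : ℝ) + 1)) • (ν - μ n)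

/-- `(p, μ)` is a Nash equilibrium (saddle point) of the game. -/
def IsNash (F : (ι → ℝ) → (X → ℝ) → ℝ) (p : ι → ℝ) (μ : X → ℝ) : Prop :=
  p ∈ stdSimplex ℝ ι ∧ μ ∈ stdSimplex ℝ X ∧
    (∀ p' ∈ stdSimplex ℝ ι, F p' μ ≤ F p μ) ∧ (∀ μ' ∈ stdSimplex ℝ X, F p μ ≤ F p μ')

/-- `v` is the optimal game value: a Nash equilibrium exists, and all have payoff `v`. -/
def IsGameValue (F : (ι → ℝ) → (X → ℝ) → ℝ) (v : ℝ) : Prop :=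
  (∃ p μ, IsNash F p μ) ∧ ∀ p μ, IsNash F p μ → F p μ = v

end Game

/-! ### Best-arm identification

A bandit model assigns to every parameter `ϑ` and arm `i` the reward distribution `P ϑ i`;
`S` is the set of admissible parameters. -/

section BAI

variable {Θ ι : Type*}

/-- The mean reward of arm `i` under the parameter `ϑ`. -/
def armMean (P : Θ → ι → Measure ℝ) (ϑ : Θ) (i : ι) : ℝ := ∫ y, y ∂(P ϑ i)

/-- `I` is the unique arm with the highest mean under `θ`. -/
def IsUniqueBestArm (P : Θ → ι → Measure ℝ) (θ : Θ) (I : ι) : Prop :=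
  ∀ j, j ≠ I → armMean P θ j < armMean P θ I

/-- The scenario `x`: the parameters under which arm `x` beats arm `I`. -/
def altSet (P : Θ → ι → Measure ℝ) (S : Set Θ) (I x : ι) : Set Θ :=
  {ϑ | ϑ ∈ S ∧ armMean P ϑ I < armMean P ϑ x}

variable [Fintype ι]

/-- `Γ (p, ϑ) = ∑ i, p i * KL (P θ i ‖ P ϑ i)`. -/
def information (P : Θ → ι → Measure ℝ) (θ : Θ) (p : ι → ℝ) (ϑ : Θ) : ℝ :=
  ∑ i, p i * (InformationTheory.klDiv (P θ i) (P ϑ i)).toReal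

/-- `D (p, x)`, the infimum of `Γ (p, ϑ)` over the scenario `x`. -/
def scenarioPayoff (P : Θ → ι → Measure ℝ) (S : Set Θ) (θ : Θ) (I : ι) (p : ι → ℝ) (x : ι) : ℝ :=
  sInf (information P θ p '' altSet P S I x)

variable [DecidableEq ι]

/-- `F (p, μ) = ∑ x, μ x * D (p, x)`, the sum over all arms `x ≠ I`. -/
def payoff (P : Θ → ι → Measure ℝ) (S : Set Θ) (θ : Θ) (I : ι)
    (p : ι → ℝ) (μ : {x : ι // x ≠ I} → ℝ) : ℝ :=
  ∑ x, μ x * scenarioPayoff P S θ I p x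

end BAI

/-! ### Canonical one-parameter exponential families, parameterized by their means -/

/-- The open natural parameter space of the family with base measure `ν`. -/
def natSpace (ν : Measure ℝ) : Set ℝ := interior (integrableExpSet id ν)

/-- The member with natural parameter `η`, of density `exp (η y - A η)` with respect to `ν`. -/
def natDist (ν : Measure ℝ) (η : ℝ) : Measure ℝ := ν.tilted (fun y => η * y)

/-- The mean of the member with natural parameter `η`. -/
def natMean (ν : Measure ℝ) (η : ℝ) : ℝ := ∫ y, y ∂(natDist ν η)

/-- The mean-parameter space. -/
def meanSpace (ν : Measure ℝ) : Set ℝ := natMean ν '' natSpace ν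

/-- The member of the family with mean `m ∈ meanSpace ν` (unique: if `ν` is not concentrated at
one point then `natMean ν` is injective on `natSpace ν`, otherwise all members coincide). -/
def meanDist (ν : Measure ℝ) (m : ℝ) : Measure ℝ :=
  natDist ν (Function.invFunOn (natMean ν) (natSpace ν) m)

/-- The unstructured bandit: arm `i` has the distribution in the family with mean `ϑ i`. -/
def expModel (ν : Measure ℝ) (K : ℕ) (ϑ : Fin K → ℝ) (i : Fin K) : Measure ℝ :=
  meanDist ν (ϑ i)

/-- The admissible parameters of the unstructured bandit. -/
def expParams (ν : Measure ℝ) (K : ℕ) : Set (Fin K → ℝ) := {ϑ | ∀ i, ϑ i ∈ meanSpace ν}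

/-! ### Gaussian linear bandits -/

/-- Arm `i` has the distribution `𝒩(aᵢ ⬝ ϑ, vᵢ)`, where `aᵢ` is the `i`-th row of `A`. -/
def linModel {K d : ℕ} (A : Matrix (Fin K) (Fin d) ℝ) (v : Fin K → ℝ≥0)
    (ϑ : Fin d → ℝ) (i : Fin K) : Measure ℝ :=
  gaussianReal (A i ⬝ᵥ ϑ) (v i)

end FWSP

end

noncomputable section

namespace FWSP

/-!
Each `D(·, x)` is a minimum of linear forms over a compact set of cost vectors, hence concave and
homogeneous of degree one. By homogeneity the play can be followed in the cumulated quantities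
`N p_N` and `N μ_N`, whose payoff is `N² F(p_N, μ_N)`. By strict convexity of the divergences,
near-minimizing costs agree in every coordinate of large weight. An answer of the first player is
therefore nearly a best response to the payoffs after it has been played, except on arms that were
played little so far, and the total regret is `o(N²)`. By summation by parts, `N² F(p_N, μ_N)` is
then, up to `o(N²)`, the sum over the rounds `r < N` of the slope `m r` of the first player's best
response and of the least cumulated payoff `U r`.

The value `v` of the game satisfies `U r ≤ r v ≤ m r`, so it remains to see that the sum of the
slopes exceeds that of the least payoffs by only `o(N²)`. Over a window of length proportional to
`N`, concavity and summation by parts bound the growth of `m` by that of `U`, up to the gaps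
`D(·, x) - U` that open after a scenario `x` was answered. An answered scenario has no gap, so its
gap after a further time `l` is at most a second difference at scale `l`. Slopes are bounded, and
passing from scale `l` to `2 l` they lose exactly the energy of these second differences; hence that
energy is small at one of boundedly many dyadic scales.
-/

section SecondDifferences

/-- The sum of the squared slopes of `g` at scale `l` over the first `N` starting points. -/
def slopeEnergy (g : ℕ → ℝ) (N l : ℕ) : ℝ :=
  ∑ i ∈ Finset.range N, ((g (i + l) - g i) / l) ^ 2

/-- The sum of the squared second differences of `g` at scale `l` over the first `N` starting
points, normalized so that it is the energy that the slopes lose between the scales `l` and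
`2 * l`. -/
def bendEnergy (g : ℕ → ℝ) (N l : ℕ) : ℝ :=
  ∑ i ∈ Finset.range N, ((g (i + 2 * l) - 2 * g (i + l) + g i) / (2 * l)) ^ 2

lemma slopeEnergy_nonneg (g : ℕ → ℝ) (N l : ℕ) : 0 ≤ slopeEnergy g N l :=
  Finset.sum_nonneg fun _ _ => sq_nonneg _

lemma bendEnergy_nonneg (g : ℕ → ℝ) (N l : ℕ) : 0 ≤ bendEnergy g N l :=
  Finset.sum_nonneg fun _ _ => sq_nonneg _

variable {g w : ℕ → ℝ} {C : ℝ}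

lemma sq_slope_le (hg : ∀ i l : ℕ, |g (i + l) - g i| ≤ C * l) (i l : ℕ) :
    ((g (i + l) - g i) / l) ^ 2 ≤ C ^ 2 := by
  have hC : 0 ≤ C := by simpa using (abs_nonneg _).trans (hg 0 1)
  rw [← sq_abs, abs_div, Nat.abs_cast]
  exact pow_le_pow_left₀ (by positivity) (div_le_of_le_mul₀ l.cast_nonneg hC (hg i l)) 2

lemma slopeEnergy_le (hg : ∀ i l : ℕ, |g (i + l) - g i| ≤ C * l) (N l : ℕ) :
    slopeEnergy g N l ≤ C ^ 2 * N :=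
  (Finset.sum_le_card_nsmul _ _ _ fun i _ => sq_slope_le hg i l).trans_eq <| by
    rw [Finset.card_range, nsmul_eq_mul, mul_comm]

lemma sum_range_shift_le_add {a : ℕ → ℝ} {B : ℝ} (ha : ∀ i, 0 ≤ a i) (hB : ∀ i, a i ≤ B)
    (N l : ℕ) : ∑ i ∈ Finset.range N, a (i + l) ≤ ∑ i ∈ Finset.range N, a i + l * B := by
  have htail : ∑ i ∈ Finset.range l, a (N + i) ≤ l * B := by
    simpa using Finset.sum_le_card_nsmul (Finset.range l) _ B fun i _ => hB (N + i)
  have hsplit := Finset.sum_range_add a l N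
  rw [add_comm l N, Finset.sum_range_add] at hsplit
  have hhead := Finset.sum_nonneg fun i (_ : i ∈ Finset.range l) => ha i
  simp only [add_comm l] at hsplit
  linarith

lemma bendEnergy_add_slopeEnergy_two_mul_le (hg : ∀ i l : ℕ, |g (i + l) - g i| ≤ C * l)
    (N l : ℕ) :
    bendEnergy g N l + slopeEnergy g N (2 * l) ≤ slopeEnergy g N l + C ^ 2 * l / 2 := by
  have hshift := sum_range_shift_le_add (fun i => sq_nonneg _) (fun i => sq_slope_le hg i l) N l
  have hparallelogram : bendEnergy g N l + slopeEnergy g N (2 * l) =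
      (slopeEnergy g N l + ∑ i ∈ Finset.range N, ((g (i + l + l) - g (i + l)) / l) ^ 2) / 2 := by
    simp only [bendEnergy, slopeEnergy]
    rw [← Finset.sum_add_distrib, ← Finset.sum_add_distrib, Finset.sum_div]
    refine Finset.sum_congr rfl fun i _ => ?_
    rcases eq_or_ne (l : ℝ) 0 with hl | hl
    · simp [hl]
    · rw [add_assoc i l l, ← two_mul l]
      push_cast
      field_simp
      ring
  simp only [slopeEnergy] at hparallelogram hshift ⊢
  linarith

lemma sum_bendEnergy_le (hg : ∀ i l : ℕ, |g (i + l) - g i| ≤ C * l) (N l J : ℕ) :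
    ∑ j ∈ Finset.range J, bendEnergy g N (2 ^ j * l) ≤ C ^ 2 * N + C ^ 2 * (2 ^ J * l) / 2 := by
  suffices h : ∑ j ∈ Finset.range J, bendEnergy g N (2 ^ j * l) + slopeEnergy g N (2 ^ J * l) ≤
      slopeEnergy g N l + C ^ 2 * ((2 ^ J - 1) * l) / 2 by
    have hl : 0 ≤ C ^ 2 * (l : ℝ) := by positivity
    linarith [slopeEnergy_nonneg g N (2 ^ J * l), slopeEnergy_le hg N l]
  induction J with
  | zero => simp
  | succ J ih =>
    have hstep := bendEnergy_add_slopeEnergy_two_mul_le hg N (2 ^ J * l)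
    rw [← mul_assoc, ← pow_succ', Nat.cast_mul, Nat.cast_pow, Nat.cast_ofNat] at hstep
    rw [Finset.sum_range_succ, pow_succ' (2 : ℝ)]
    linarith

lemma sum_abs_secondDifference_le {ρ : ℝ} (hρ : 0 ≤ ρ) {N l : ℕ}
    (hbend : bendEnergy g N l ≤ ρ ^ 2 * N) :
    ∑ i ∈ Finset.range N, |g (i + 2 * l) - 2 * g (i + l) + g i| ≤ 2 * l * ρ * N := by
  rcases eq_or_ne (l : ℝ) 0 with hl | hl
  · obtain rfl : l = 0 := by exact_mod_cast hl
    refine (Finset.sum_eq_zero fun i _ => ?_).trans_le (by simp)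
    rw [abs_eq_zero]
    simp only [mul_zero, add_zero]
    ring
  have hcs : (∑ i ∈ Finset.range N, |(g (i + 2 * l) - 2 * g (i + l) + g i) / (2 * l)|) ^ 2 ≤
      (ρ * N) ^ 2 := by
    refine sq_sum_le_card_mul_sum_sq.trans ?_
    simp only [sq_abs, Finset.card_range]
    refine (mul_le_mul_of_nonneg_left hbend N.cast_nonneg).trans_eq (by ring)
  have h := (le_abs_self _).trans (abs_le_of_sq_le_sq hcs (by positivity))
  simp only [abs_div, ← Finset.sum_div, abs_mul, Nat.abs_cast, Nat.abs_ofNat] at h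
  rw [div_le_iff₀ (by positivity)] at h
  linarith

lemma sum_mul_shift_le_of_bendEnergy_le (hg : ∀ i l : ℕ, |g (i + l) - g i| ≤ C * l)
    (hg0 : ∀ i, 0 ≤ g i) (hw0 : ∀ i, 0 ≤ w i) (hw1 : ∀ i, w i ≤ 1) (hwg : ∀ i, w i * g i = 0)
    {ρ : ℝ} (hρ : 0 ≤ ρ) {N l : ℕ} (hbend : bendEnergy g N l ≤ ρ ^ 2 * N) :
    ∑ i ∈ Finset.range N, w i * g (i + l) ≤ C * l * l + 2 * l * ρ * N := by
  have hhead : ∑ i ∈ Finset.range l, w i * g (i + l) ≤ C * l * l := by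
    refine (Finset.sum_le_card_nsmul _ _ (C * l) fun i _ => ?_).trans_eq ?_
    · calc w i * g (i + l) = w i * (g (i + l) - g i) := by rw [mul_sub, hwg, sub_zero]
        _ ≤ w i * (C * l) := mul_le_mul_of_nonneg_left ((le_abs_self _).trans (hg i l)) (hw0 i)
        _ ≤ C * l := mul_le_of_le_one_left ((abs_nonneg _).trans (hg i l)) (hw1 i)
    · rw [Finset.card_range, nsmul_eq_mul, mul_comm]
  have htail (i : ℕ) : w (l + i) * g (l + i + l) ≤ |g (i + 2 * l) - 2 * g (i + l) + g i| := by
    rw [show l + i + l = i + 2 * l by ring, add_comm l i]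
    calc w (i + l) * g (i + 2 * l) = w (i + l) * (g (i + 2 * l) - 2 * g (i + l)) := by
          linear_combination 2 * hwg (i + l)
      _ ≤ w (i + l) * (g (i + 2 * l) - 2 * g (i + l) + g i) :=
          mul_le_mul_of_nonneg_left (le_add_of_nonneg_right (hg0 i)) (hw0 _)
      _ ≤ w (i + l) * |g (i + 2 * l) - 2 * g (i + l) + g i| :=
          mul_le_mul_of_nonneg_left (le_abs_self _) (hw0 _)
      _ ≤ |g (i + 2 * l) - 2 * g (i + l) + g i| := mul_le_of_le_one_left (abs_nonneg _) (hw1 _)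
  calc ∑ i ∈ Finset.range N, w i * g (i + l)
      ≤ ∑ i ∈ Finset.range (l + N), w i * g (i + l) :=
        Finset.sum_le_sum_of_subset_of_nonneg (Finset.range_mono (Nat.le_add_left N l))
          fun i _ _ => mul_nonneg (hw0 i) (hg0 _)
    _ ≤ C * l * l + 2 * l * ρ * N := by
        rw [Finset.sum_range_add]
        exact add_le_add hhead
          ((Finset.sum_le_sum fun i _ => htail i).trans (sum_abs_secondDifference_le hρ hbend))

lemma sum_mul_shift_add_le (hg : ∀ i l : ℕ, |g (i + l) - g i| ≤ C * l)
    (hw0 : ∀ i, 0 ≤ w i) (hw1 : ∀ i, w i ≤ 1) (N l r : ℕ) :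
    ∑ i ∈ Finset.range N, w i * g (i + (l + r)) ≤
      ∑ i ∈ Finset.range N, w i * g (i + l) + C * r * N := by
  have hstep (i : ℕ) : w i * g (i + (l + r)) - w i * g (i + l) ≤ C * r := by
    rw [← mul_sub, ← add_assoc]
    exact (mul_le_mul_of_nonneg_left ((le_abs_self _).trans (hg _ r)) (hw0 i)).trans
      (mul_le_of_le_one_left ((abs_nonneg _).trans (hg 0 r)) (hw1 i))
  have hsum := Finset.sum_le_card_nsmul (Finset.range N) _ _ fun i _ => hstep i
  rw [Finset.sum_sub_distrib, Finset.card_range, nsmul_eq_mul, mul_comm] at hsum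
  linarith

lemma sum_mul_shift_le_of_forall_bendEnergy_le (hg : ∀ i l : ℕ, |g (i + l) - g i| ≤ C * l)
    (hg0 : ∀ i, 0 ≤ g i) (hw0 : ∀ i, 0 ≤ w i) (hw1 : ∀ i, w i ≤ 1) (hwg : ∀ i, w i * g i = 0)
    {δ : ℝ} (hδ : 0 ≤ δ) {N L h l : ℕ} (hLδ : 1 ≤ δ * L) (hh : 0 < h) (hLh : L * h ≤ δ * N)
    (hbend : ∀ b ≤ L, bendEnergy g N (b * h) ≤ δ ^ 2 * N) (hl : l ≤ L * h) :
    ∑ i ∈ Finset.range N, w i * g (i + l) ≤ (2 * |C| + 2) * δ * (L * h * N) := by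
  have hb : l / h ≤ L := Nat.div_le_of_le_mul (by rwa [mul_comm])
  have hsplit := sum_mul_shift_add_le hg hw0 hw1 N (l / h * h) (l % h)
  rw [Nat.div_add_mod'] at hsplit
  have hlattice := sum_mul_shift_le_of_bendEnergy_le hg hg0 hw0 hw1 hwg hδ (hbend _ hb)
  have hbh : ((l / h * h : ℕ) : ℝ) ≤ L * h := by exact_mod_cast Nat.mul_le_mul_right h hb
  have hr : ((l % h : ℕ) : ℝ) ≤ δ * L * h := by
    refine le_trans ?_ (le_mul_of_one_le_left h.cast_nonneg hLδ)
    exact_mod_cast (Nat.mod_lt l hh).le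
  have hC := le_abs_self C
  calc ∑ i ∈ Finset.range N, w i * g (i + l)
      ≤ |C| * (L * h) * (δ * N) + 2 * (L * h) * δ * N + |C| * (δ * L * h) * N := by
        refine (hsplit.trans (add_le_add_left hlattice _)).trans ?_
        have := hbh.trans hLh
        gcongr
    _ = (2 * |C| + 2) * δ * (L * h * N) := by ring

end SecondDifferences

section GoodScale

variable {X : Type*} {g w : X → ℕ → ℝ} {C : ℝ}

lemma exists_forall_bendEnergy_le [Fintype X]
    (hg : ∀ x, ∀ i l : ℕ, |g x (i + l) - g x i| ≤ C * l)
    {N L h J : ℕ} {B : ℝ} (hJ : 0 < J)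
    (hB : Fintype.card X * (L + 1) * (C ^ 2 * N + C ^ 2 * (2 ^ J * (L * h)) / 2) ≤ J * B) :
    ∃ j < J, ∀ x, ∀ b ≤ L, bendEnergy (g x) N (b * (2 ^ j * h)) ≤ B := by
  set total : ℕ → ℝ := fun j => ∑ x, ∑ b ∈ Finset.range (L + 1),
    bendEnergy (g x) N (b * (2 ^ j * h)) with htotal
  have hscale (x : X) (b : ℕ) (hb : b ∈ Finset.range (L + 1)) :
      ∑ j ∈ Finset.range J, bendEnergy (g x) N (b * (2 ^ j * h)) ≤
        C ^ 2 * N + C ^ 2 * (2 ^ J * (L * h)) / 2 := by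
    simp only [mul_left_comm b]
    refine (sum_bendEnergy_le (hg x) N (b * h) J).trans ?_
    have hbL : (b : ℝ) ≤ L := by exact_mod_cast Finset.mem_range_succ_iff.1 hb
    rw [Nat.cast_mul]
    gcongr
  have hsum : ∑ j ∈ Finset.range J, total j ≤ ∑ _j ∈ Finset.range J, B := by
    rw [Finset.sum_const, Finset.card_range, nsmul_eq_mul]
    refine le_trans ?_ hB
    rw [htotal, Finset.sum_comm]
    refine (Finset.sum_le_card_nsmul _ _ ((L + 1) *
      (C ^ 2 * N + C ^ 2 * (2 ^ J * (L * h)) / 2)) fun x _ => ?_).trans_eq ?_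
    · rw [Finset.sum_comm]
      refine (Finset.sum_le_card_nsmul _ _ _ (hscale x)).trans_eq ?_
      rw [Finset.card_range, nsmul_eq_mul, Nat.cast_add_one]
    · rw [Finset.card_univ, nsmul_eq_mul, mul_assoc]
  obtain ⟨j, hj, hle⟩ := Finset.exists_le_of_sum_le (Finset.nonempty_range_iff.2 hJ.ne') hsum
  refine ⟨j, Finset.mem_range.1 hj, fun x b hb => le_trans ?_ hle⟩
  calc bendEnergy (g x) N (b * (2 ^ j * h))
      ≤ ∑ b ∈ Finset.range (L + 1), bendEnergy (g x) N (b * (2 ^ j * h)) :=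
        Finset.single_le_sum (f := fun b => bendEnergy (g x) N (b * (2 ^ j * h)))
          (fun _ _ => bendEnergy_nonneg _ _ _) (Finset.mem_range_succ_iff.2 hb)
    _ ≤ total j :=
        Finset.single_le_sum (f := fun x => ∑ b ∈ Finset.range (L + 1),
            bendEnergy (g x) N (b * (2 ^ j * h)))
          (fun _ _ => Finset.sum_nonneg fun _ _ => bendEnergy_nonneg _ _ _) (Finset.mem_univ x)

lemma eventually_half_mul_le_floor {a : ℝ} (ha : 0 < a) :
    ∀ᶠ N : ℕ in atTop, a / 2 * N ≤ ⌊a * N⌋₊ := by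
  filter_upwards [(tendsto_natCast_atTop_atTop.const_mul_atTop ha).eventually_ge_atTop 2] with N hN
  linarith [Nat.sub_one_lt_floor (a * (N : ℝ))]

lemma eventually_exists_scale_forall_bendEnergy_le [Finite X]
    (hg : ∀ x, ∀ i l : ℕ, |g x (i + l) - g x i| ≤ C * l) {η ε : ℝ} (hη : 0 < η) (hε : 0 < ε)
    (L : ℕ) :
    ∃ c > (0 : ℝ), ∀ᶠ N : ℕ in atTop, ∃ h : ℕ, c * N ≤ h ∧ L * h ≤ ε * N ∧
      ∀ x, ∀ b ≤ L, bendEnergy (g x) N (b * h) ≤ η * N := by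
  have := Fintype.ofFinite X
  obtain ⟨J, hJ⟩ := exists_nat_gt
    (Fintype.card X * (L + 1) * (C ^ 2 + C ^ 2 * ε / 2) / η)
  have hJ0 : 0 < J := Nat.cast_pos.1 (lt_of_le_of_lt (by positivity) hJ)
  rw [div_lt_iff₀ hη] at hJ
  set a : ℝ := ε / (2 ^ J * (L + 1)) with ha
  have ha0 : 0 < a := by positivity
  refine ⟨a / 2, by positivity, ?_⟩
  filter_upwards [eventually_half_mul_le_floor ha0] with N hN
  set h := ⌊a * N⌋₊
  have hsmall : 2 ^ J * (L * h) ≤ ε * N := by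
    have hle : (h : ℝ) ≤ a * N := Nat.floor_le (by positivity)
    calc (2 : ℝ) ^ J * (L * h) ≤ 2 ^ J * ((L + 1) * (a * N)) := by gcongr; linarith
      _ = ε * N := by rw [ha]; field_simp
  obtain ⟨j, hj, hbend⟩ := exists_forall_bendEnergy_le (L := L) (h := h) hg (B := η * N) hJ0 <| by
    calc Fintype.card X * (L + 1) * (C ^ 2 * N + C ^ 2 * (2 ^ J * (L * h)) / 2)
        ≤ Fintype.card X * (L + 1) * (C ^ 2 * N + C ^ 2 * (ε * N) / 2) := by gcongr
      _ = Fintype.card X * (L + 1) * (C ^ 2 + C ^ 2 * ε / 2) * N := by ring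
      _ ≤ J * (η * N) := by rw [← mul_assoc]; gcongr
  refine ⟨2 ^ j * h, hN.trans ?_, le_trans ?_ hsmall, hbend⟩
  · exact_mod_cast Nat.le_mul_of_pos_left h (by positivity)
  · push_cast
    rw [mul_left_comm]
    gcongr
    exact one_le_two

lemma eventually_exists_scale_forall_sum_mul_shift_le [Fintype X]
    (hg : ∀ x, ∀ i l : ℕ, |g x (i + l) - g x i| ≤ C * l) (hg0 : ∀ x i, 0 ≤ g x i)
    (hw0 : ∀ x i, 0 ≤ w x i) (hw1 : ∀ x i, w x i ≤ 1) (hwg : ∀ x i, w x i * g x i = 0)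
    {ε : ℝ} (hε : 0 < ε) :
    ∃ c > (0 : ℝ), ∀ᶠ N : ℕ in atTop, ∃ k : ℕ, c * N ≤ k ∧ k ≤ ε * N ∧
      ∀ l ≤ k, ∑ x, ∑ i ∈ Finset.range N, w x i * g x (i + l) ≤ ε * k * N := by
  obtain ⟨δ, hδ, hδε, hδX⟩ : ∃ δ > 0, δ ≤ ε ∧ Fintype.card X * ((2 * |C| + 2) * δ) ≤ ε := by
    refine ⟨ε / (1 + Fintype.card X * (2 * |C| + 2)), by positivity,
      div_le_self hε.le (le_add_of_nonneg_right (by positivity)), ?_⟩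
    rw [← mul_assoc, ← mul_div_assoc, div_le_iff₀ (by positivity)]
    linarith
  obtain ⟨L, hL⟩ := exists_nat_ge (1 / δ)
  have hLδ : 1 ≤ δ * L := by rwa [div_le_iff₀' hδ] at hL
  obtain ⟨c, hc, hev⟩ := eventually_exists_scale_forall_bendEnergy_le hg (pow_pos hδ 2) hδ L
  refine ⟨c * L, mul_pos hc ((pos_iff_pos_of_mul_pos (zero_lt_one.trans_le hLδ)).1 hδ), ?_⟩
  filter_upwards [hev, eventually_gt_atTop 0] with N ⟨h, hch, hLh, hbend⟩ hN
  have hh : 0 < h := by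
    exact_mod_cast (mul_pos hc (Nat.cast_pos.2 hN)).trans_le hch
  refine ⟨L * h, ?_, ?_, fun l hl => ?_⟩
  · rw [mul_right_comm, mul_comm, Nat.cast_mul]
    gcongr
  · rw [Nat.cast_mul]
    exact hLh.trans (by gcongr)
  have hterm (x : X) : ∑ i ∈ Finset.range N, w x i * g x (i + l) ≤
      (2 * |C| + 2) * δ * (L * h * N) :=
    sum_mul_shift_le_of_forall_bendEnergy_le (hg x) (hg0 x) (hw0 x) (hw1 x) (hwg x) hδ.le hLδ hh
      hLh (hbend x) hl
  calc ∑ x, ∑ i ∈ Finset.range N, w x i * g x (i + l)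
      ≤ Fintype.card X * ((2 * |C| + 2) * δ * (L * h * N)) := by
        simpa using Finset.sum_le_card_nsmul Finset.univ _ _ fun x _ => hterm x
    _ = Fintype.card X * ((2 * |C| + 2) * δ) * (L * h * N) := by ring
    _ ≤ ε * (L * h * N) := by gcongr
    _ = ε * (L * h : ℕ) * N := by push_cast; ring

end GoodScale

section DoubleSummation

lemma sum_range_cast (k : ℕ) : ∑ j ∈ Finset.range k, (j : ℝ) = k * (k - 1) / 2 := by
  induction k with
  | zero => simp
  | succ k ih =>
    rw [Finset.sum_range_succ, ih]
    push_cast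
    ring

lemma sum_range_shift_sub (f : ℕ → ℝ) (n j : ℕ) :
    ∑ s ∈ Finset.range n, (f (s + j) - f s) = ∑ i ∈ Finset.range j, (f (n + i) - f i) := by
  have hleft := Finset.sum_range_add f n j
  have hright := Finset.sum_range_add f j n
  rw [add_comm j n] at hright
  simp only [Finset.sum_sub_distrib, add_comm _ j]
  linarith

variable {m U E : ℕ → ℝ} {C B : ℝ} {k N : ℕ}

lemma le_sum_sum_shift_sub (hC : 0 ≤ C) (hm0 : ∀ i, 0 ≤ m i) (hm : ∀ i, m i ≤ C * i)
    (hkN : k ≤ N) {j : ℕ} (hj : j ≤ k) :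
    j * (∑ r ∈ Finset.range N, m r - 2 * N * C * k) ≤
      ∑ n ∈ Finset.range N, ∑ s ∈ Finset.range n, (m (s + j) - m s) := by
  have hmk {i : ℕ} (hi : i < k) : m i ≤ C * k :=
    (hm i).trans (mul_le_mul_of_nonneg_left (by exact_mod_cast hi.le) hC)
  simp only [sum_range_shift_sub m _ j]
  rw [Finset.sum_comm, ← nsmul_eq_mul]
  nth_rewrite 1 [← Finset.card_range j]
  refine Finset.card_nsmul_le_sum _ _ _ fun i hi => ?_
  have hik : i < k := (Finset.mem_range.1 hi).trans_le hj
  have hshift : -(i * (C * k)) ≤ ∑ n ∈ Finset.range N, (m (n + i) - m n) := by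
    rw [sum_range_shift_sub, ← mul_neg]
    simpa using Finset.card_nsmul_le_sum (Finset.range i) (fun i' => m (N + i') - m i') (-(C * k))
      fun i' hi' => by linarith [hm0 (N + i'), hmk ((Finset.mem_range.1 hi').trans hik)]
  rw [Finset.sum_sub_distrib] at hshift ⊢
  rw [Finset.sum_const, Finset.card_range, nsmul_eq_mul]
  have hindex : i * (C * k) ≤ N * (C * k) := by
    have : i ≤ N := hik.le.trans hkN
    gcongr
  have hvalue : N * m i ≤ N * (C * k) := by have := hmk hik; gcongr
  linarith

lemma sum_sum_sub_le (hC : 0 ≤ C) (hU0 : ∀ i, 0 ≤ U i)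
    (hU : ∀ i l : ℕ, U (i + l) ≤ U i + C * l) {j : ℕ}
    (hj : j ≤ k) :
    ∑ n ∈ Finset.range N, ∑ s ∈ Finset.range n, (U (s + k) - U (s + j)) ≤
      (k - j) * (∑ r ∈ Finset.range N, U r + N * C * k) := by
  have hinner (n : ℕ) :
      ∑ s ∈ Finset.range n, (U (s + k) - U (s + j)) ≤ (k - j) * (U n + C * k) := by
    have htelescope : ∑ s ∈ Finset.range n, (U (s + k) - U (s + j)) =
        ∑ i ∈ Finset.Ico j k, (U (n + i) - U i) := by
      rw [Finset.sum_Ico_eq_sub _ hj, ← sum_range_shift_sub, ← sum_range_shift_sub,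
        ← Finset.sum_sub_distrib]
      exact Finset.sum_congr rfl fun s _ => by ring
    rw [htelescope, ← Nat.cast_sub hj, ← nsmul_eq_mul, ← Nat.card_Ico]
    refine Finset.sum_le_card_nsmul _ _ _ fun i hi => ?_
    have hik : C * i ≤ C * k :=
      mul_le_mul_of_nonneg_left (by exact_mod_cast (Finset.mem_Ico.1 hi).2.le) hC
    linarith [hU n i, hU0 i]
  refine (Finset.sum_le_sum fun n _ => hinner n).trans_eq ?_
  rw [← Finset.mul_sum, Finset.sum_add_distrib, Finset.sum_const, Finset.card_range, nsmul_eq_mul,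
    mul_assoc (N : ℝ)]

/-- Summing `hwindow` over `s < n` and then over `n < N` telescopes the increments of `m` and `U`
into their sums. -/
lemma sum_le_sum_add_of_window (hC : 0 ≤ C) (hm0 : ∀ i, 0 ≤ m i) (hm : ∀ i, m i ≤ C * i)
    (hU0 : ∀ i, 0 ≤ U i) (hU : ∀ i l : ℕ, U (i + l) ≤ U i + C * l) (hE0 : ∀ s, 0 ≤ E s)
    (hE : ∑ s ∈ Finset.range N, E s ≤ B) (hk : 0 < k) (hkN : k ≤ N)
    (hwindow : ∀ s, ∑ j ∈ Finset.range k, (m (s + j) - m s) ≤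
      ∑ j ∈ Finset.range k, (U (s + k) - U (s + j)) + E s) :
    ∑ r ∈ Finset.range N, m r ≤ ∑ r ∈ Finset.range N, U r +
      (∑ r ∈ Finset.range N, m r + ∑ r ∈ Finset.range N, U r) / k + 4 * N * C * k +
      2 * N * B / k ^ 2 := by
  have hErr : ∑ n ∈ Finset.range N, ∑ s ∈ Finset.range n, E s ≤ N * B := by
    simpa using Finset.sum_le_card_nsmul (Finset.range N) (fun n => ∑ s ∈ Finset.range n, E s) B
      fun n hn => (Finset.sum_le_sum_of_subset_of_nonneg
        (Finset.range_mono (Finset.mem_range.1 hn).le) fun s _ _ => hE0 s).trans hE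
  have htwice : ∑ j ∈ Finset.range k,
        ∑ n ∈ Finset.range N, ∑ s ∈ Finset.range n, (m (s + j) - m s) ≤
      ∑ j ∈ Finset.range k,
        ∑ n ∈ Finset.range N, ∑ s ∈ Finset.range n, (U (s + k) - U (s + j)) + N * B := by
    have hsum := Finset.sum_le_sum fun n (_ : n ∈ Finset.range N) =>
      Finset.sum_le_sum fun s (_ : s ∈ Finset.range n) => hwindow s
    simp only [Finset.sum_add_distrib, Finset.sum_comm (t := Finset.range k)] at hsum
    linarith
  have hlow := Finset.sum_le_sum fun j (hj : j ∈ Finset.range k) =>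
    le_sum_sum_shift_sub hC hm0 hm hkN (Finset.mem_range.1 hj).le
  have hup := Finset.sum_le_sum fun j (hj : j ∈ Finset.range k) =>
    sum_sum_sub_le (N := N) hC hU0 hU (Finset.mem_range.1 hj).le
  rw [← Finset.sum_mul, sum_range_cast] at hlow
  rw [← Finset.sum_mul, Finset.sum_sub_distrib, sum_range_cast, Finset.sum_const,
    Finset.card_range, nsmul_eq_mul] at hup
  set S := ∑ r ∈ Finset.range N, m r
  set T := ∑ r ∈ Finset.range N, U r
  have hNC : 0 ≤ N * C * k ^ 2 := by positivity
  have hNCk : 0 ≤ N * C * k ^ 3 := by positivity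
  have hmul : S * k ^ 2 ≤ (T + (S + T) / k + 4 * N * C * k + 2 * N * B / k ^ 2) * k ^ 2 := by
    field_simp
    linarith
  exact le_of_mul_le_mul_right hmul (by positivity)

end DoubleSummation

section SelfPlay

variable {X : Type*} [Fintype X]

/-- The amount by which, in round `r`, the growth of the payoffs `d` weighted with the cumulated
weights `w` falls short of the best possible growth `m r`. -/
def regret (d w : X → ℕ → ℝ) (m : ℕ → ℝ) (r : ℕ) : ℝ :=
  m r - ∑ x, (∑ i ∈ Finset.range r, w x i) * (d x (r + 1) - d x r)

/-- The bookkeeping of a run of self-play in cumulated (not averaged) quantities: after `r` rounds,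
`d x r` is the payoff of scenario `x` against the cumulated play of the first player, `U r` is the
least of these payoffs, `w x r` is the weight the second player then gives to `x`, and `m r` is the
slope of the first player's best response to the cumulated weights. The number `v` is the value of
the game, and by `sum_regret` the first player does asymptotically as well as by best responses. -/
structure IsSelfPlay (d w : X → ℕ → ℝ) (U m : ℕ → ℝ) (C v : ℝ) : Prop where
  weight_nonneg : ∀ x r, 0 ≤ w x r
  sum_weight : ∀ r, ∑ x, w x r = 1
  payoff_nonneg : ∀ x r, 0 ≤ d x r
  payoff_mono : ∀ x, Monotone (d x)
  payoff_add_le : ∀ x, ∀ r l : ℕ, d x (r + l) ≤ d x r + C * l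
  value_le : ∀ x r, U r ≤ d x r
  weight_mul_gap : ∀ x r, w x r * (d x r - U r) = 0
  sum_increment_le : ∀ s l : ℕ,
    ∑ x, (∑ i ∈ Finset.range s, w x i) * (d x (s + l) - d x s) ≤ l * m s
  slope_le : ∀ r : ℕ, m r ≤ C * r
  le_slope : ∀ r : ℕ, r * v ≤ m r
  value_le_mul : ∀ r : ℕ, U r ≤ r * v
  sum_regret : (fun N => ∑ r ∈ Finset.range N, regret d w m r) =o[atTop]
    fun N : ℕ => (N : ℝ) ^ 2

lemma sum_range_mul_sub_le {d w : ℕ → ℝ} (hd : Monotone d) (hw : ∀ i, 0 ≤ w i) (s k : ℕ) :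
    ∑ j ∈ Finset.range k, (∑ i ∈ Finset.range (s + j), w i) * (d (s + j + 1) - d (s + j)) ≤
      (∑ i ∈ Finset.range s, w i) * (d (s + k) - d s) +
        ∑ j ∈ Finset.range k, w (s + j) * (d (s + k) - d (s + j)) := by
  induction k with
  | zero => simp
  | succ k ih =>
    have hinc : 0 ≤ w (s + k) * (d (s + k + 1) - d (s + k)) :=
      mul_nonneg (hw _) (sub_nonneg.2 (hd (Nat.le_succ _)))
    have hsplit : ∑ j ∈ Finset.range k, w (s + j) * (d (s + k + 1) - d (s + j)) =
        ∑ j ∈ Finset.range k, w (s + j) * (d (s + k) - d (s + j)) +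
          (∑ j ∈ Finset.range k, w (s + j)) * (d (s + k + 1) - d (s + k)) := by
      rw [Finset.sum_mul, ← Finset.sum_add_distrib]
      exact Finset.sum_congr rfl fun j _ => by ring
    rw [Finset.sum_range_succ, Finset.sum_range_succ, ← add_assoc s k 1, hsplit,
      Finset.sum_range_add]
    linarith

namespace IsSelfPlay

variable {d w : X → ℕ → ℝ} {U m : ℕ → ℝ} {C v : ℝ}

lemma weight_le_one (h : IsSelfPlay d w U m C v) (x : X) (r : ℕ) : w x r ≤ 1 :=
  (Finset.single_le_sum (f := fun x => w x r) (fun x _ => h.weight_nonneg x r)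
    (Finset.mem_univ x)).trans_eq (h.sum_weight r)

lemma sum_weight_mul_payoff (h : IsSelfPlay d w U m C v) (r : ℕ) :
    ∑ x, w x r * d x r = U r := by
  have hgap := Finset.sum_eq_zero fun x (_ : x ∈ Finset.univ) => h.weight_mul_gap x r
  simp only [mul_sub, Finset.sum_sub_distrib, ← Finset.sum_mul] at hgap
  rw [sub_eq_zero.1 hgap, h.sum_weight, one_mul]

lemma le_sum_weight_mul_payoff (h : IsSelfPlay d w U m C v) (r s : ℕ) :
    U s ≤ ∑ x, w x r * d x s := by
  calc U s = ∑ x, w x r * U s := by rw [← Finset.sum_mul, h.sum_weight, one_mul]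
    _ ≤ ∑ x, w x r * d x s :=
      Finset.sum_le_sum fun x _ => mul_le_mul_of_nonneg_left (h.value_le x s) (h.weight_nonneg x r)

lemma value_nonneg (h : IsSelfPlay d w U m C v) (r : ℕ) : 0 ≤ U r := by
  rw [← h.sum_weight_mul_payoff]
  exact Finset.sum_nonneg fun x _ => mul_nonneg (h.weight_nonneg x r) (h.payoff_nonneg x r)

lemma value_le_value_add (h : IsSelfPlay d w U m C v) (r l : ℕ) : U r ≤ U (r + l) := by
  rw [← h.sum_weight_mul_payoff (r + l)]
  exact (h.le_sum_weight_mul_payoff (r + l) r).trans (Finset.sum_le_sum fun x _ =>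
    mul_le_mul_of_nonneg_left (h.payoff_mono x (Nat.le_add_right r l)) (h.weight_nonneg x _))

lemma value_add_le (h : IsSelfPlay d w U m C v) (r l : ℕ) : U (r + l) ≤ U r + C * l := by
  calc U (r + l) ≤ ∑ x, w x r * d x (r + l) := h.le_sum_weight_mul_payoff r (r + l)
    _ ≤ ∑ x, w x r * (d x r + C * l) := Finset.sum_le_sum fun x _ =>
        mul_le_mul_of_nonneg_left (h.payoff_add_le x r l) (h.weight_nonneg x r)
    _ = U r + C * l := by
        simp only [mul_add, Finset.sum_add_distrib, ← Finset.sum_mul, h.sum_weight,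
          h.sum_weight_mul_payoff, one_mul]

lemma abs_gap_sub_le (h : IsSelfPlay d w U m C v) (x : X) (i l : ℕ) :
    |(d x (i + l) - U (i + l)) - (d x i - U i)| ≤ C * l := by
  have hd := h.payoff_mono x (Nat.le_add_right i l)
  rw [abs_le]
  constructor <;>
    linarith [h.payoff_add_le x i l, h.value_le_value_add i l, h.value_add_le i l]

lemma sum_increment_nonneg (h : IsSelfPlay d w U m C v) (s l : ℕ) :
    0 ≤ ∑ x, (∑ i ∈ Finset.range s, w x i) * (d x (s + l) - d x s) :=
  Finset.sum_nonneg fun x _ => mul_nonneg (Finset.sum_nonneg fun i _ => h.weight_nonneg x i)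
    (sub_nonneg.2 (h.payoff_mono x (Nat.le_add_right s l)))

lemma slope_nonneg (h : IsSelfPlay d w U m C v) (r : ℕ) : 0 ≤ m r := by
  simpa using (h.sum_increment_nonneg r 1).trans (h.sum_increment_le r 1)

lemma const_nonneg (h : IsSelfPlay d w U m C v) : 0 ≤ C := by
  simpa using (h.slope_nonneg 1).trans (h.slope_le 1)

lemma regret_nonneg (h : IsSelfPlay d w U m C v) (r : ℕ) :
    0 ≤ regret d w m r := by
  simpa [regret] using h.sum_increment_le r 1

lemma sum_weight_mul_increment (h : IsSelfPlay d w U m C v) (i l : ℕ) :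
    ∑ x, w x i * (d x (i + l) - d x i) =
      U (i + l) - U i + ∑ x, w x i * (d x (i + l) - U (i + l)) := by
  simp only [mul_sub, Finset.sum_sub_distrib, ← Finset.sum_mul, h.sum_weight,
    h.sum_weight_mul_payoff]
  ring

/-- Summation by parts over the window `s, …, s + k`: the weights played inside the window see the
growth of `U`, up to the gaps `d x - U` that open after they are played. -/
lemma sum_slope_sub_le (h : IsSelfPlay d w U m C v) (s k : ℕ) :
    ∑ j ∈ Finset.range k, (m (s + j) - m s) ≤
      ∑ j ∈ Finset.range k, (U (s + k) - U (s + j)) +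
      ∑ j ∈ Finset.range k, (∑ x, w x (s + j) * (d x (s + k) - U (s + k)) +
        regret d w m (s + j)) := by
  have hparts := Finset.sum_le_sum fun x (_ : x ∈ Finset.univ) =>
    sum_range_mul_sub_le (h.payoff_mono x) (h.weight_nonneg x) s k
  rw [Finset.sum_add_distrib, Finset.sum_comm, Finset.sum_comm (t := Finset.range k)] at hparts
  have hwindow : ∑ j ∈ Finset.range k, ∑ x, w x (s + j) * (d x (s + k) - d x (s + j)) =
      ∑ j ∈ Finset.range k, (U (s + k) - U (s + j) +
        ∑ x, w x (s + j) * (d x (s + k) - U (s + k))) := by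
    refine Finset.sum_congr rfl fun j hj => ?_
    have hjk := h.sum_weight_mul_increment (s + j) (k - j)
    rwa [add_assoc, Nat.add_sub_cancel' (Finset.mem_range.1 hj).le] at hjk
  have hconst : ∑ _j ∈ Finset.range k, m s = k * m s := by simp
  simp only [regret, Finset.sum_add_distrib, Finset.sum_sub_distrib] at hparts hwindow ⊢
  linarith [h.sum_increment_le s k]

lemma sum_slope_le (h : IsSelfPlay d w U m C v) (N : ℕ) :
    ∑ r ∈ Finset.range N, m r ≤ C * N ^ 2 := by
  refine (Finset.sum_le_card_nsmul _ _ (C * N) fun r hr => (h.slope_le r).trans ?_).trans_eq ?_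
  · exact mul_le_mul_of_nonneg_left (by exact_mod_cast (Finset.mem_range.1 hr).le) h.const_nonneg
  · rw [Finset.card_range, nsmul_eq_mul]
    ring

lemma sum_value_le (h : IsSelfPlay d w U m C v) (N : ℕ) :
    ∑ r ∈ Finset.range N, U r ≤ C * N ^ 2 :=
  (Finset.sum_le_sum fun r _ => (h.value_le_mul r).trans (h.le_slope r)).trans (h.sum_slope_le N)

lemma sum_window_error_le (h : IsSelfPlay d w U m C v) {k N : ℕ} (hkN : k ≤ N) {B R : ℝ}
    (hB : ∀ l ≤ k, ∑ x, ∑ i ∈ Finset.range (2 * N), w x i * (d x (i + l) - U (i + l)) ≤ B)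
    (hR : ∑ i ∈ Finset.range (2 * N), regret d w m i ≤ R) :
    ∑ s ∈ Finset.range N, ∑ j ∈ Finset.range k,
      (∑ x, w x (s + j) * (d x (s + k) - U (s + k)) + regret d w m (s + j)) ≤ k * (B + R) := by
  have hshift {f : ℕ → ℝ} (hf : ∀ i, 0 ≤ f i) {j : ℕ} (hj : j ≤ N) :
      ∑ s ∈ Finset.range N, f (s + j) ≤ ∑ i ∈ Finset.range (2 * N), f i := by
    simp only [add_comm _ j]
    refine le_trans ?_ (Finset.sum_le_sum_of_subset_of_nonneg
      (Finset.range_mono (by lia : j + N ≤ 2 * N)) fun i _ _ => hf i)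
    rw [Finset.sum_range_add]
    exact le_add_of_nonneg_left (Finset.sum_nonneg fun i _ => hf i)
  have hround (j : ℕ) (hj : j ∈ Finset.range k) : ∑ s ∈ Finset.range N,
      (∑ x, w x (s + j) * (d x (s + k) - U (s + k)) + regret d w m (s + j)) ≤ B + R := by
    have hjk := (Finset.mem_range.1 hj).le
    have hgap := hshift (f := fun i => ∑ x, w x i * (d x (i + (k - j)) - U (i + (k - j))))
      (fun i => Finset.sum_nonneg fun x _ => mul_nonneg (h.weight_nonneg x i)
        (sub_nonneg.2 (h.value_le x _))) (hjk.trans hkN)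
    simp only [add_assoc, Nat.add_sub_cancel' hjk] at hgap
    rw [Finset.sum_comm (s := Finset.range (2 * N))] at hgap
    rw [Finset.sum_add_distrib]
    exact add_le_add (hgap.trans (hB (k - j) (Nat.sub_le k j)))
      ((hshift h.regret_nonneg (hjk.trans hkN)).trans hR)
  rw [Finset.sum_comm]
  simpa only [Finset.card_range, nsmul_eq_mul] using Finset.sum_le_card_nsmul _ _ _ hround

lemma sum_slope_le_of_scale (h : IsSelfPlay d w U m C v) {δ : ℝ} {N k : ℕ} (hk : 0 < k)
    (hkN : k ≤ N) (hkδ : k ≤ δ * (2 * N)) (hCk : 2 * C ≤ δ * k)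
    (hgap : ∀ l ≤ k, ∑ x, ∑ i ∈ Finset.range (2 * N), w x i * (d x (i + l) - U (i + l)) ≤
      δ * k * (2 * N))
    (hR : ∑ i ∈ Finset.range (2 * N), regret d w m i ≤ 2 * δ * k * N) :
    ∑ r ∈ Finset.range N, m r ≤ ∑ r ∈ Finset.range N, U r + (8 * C + 9) * δ * N ^ 2 := by
  have hC := h.const_nonneg
  have hk0 : (0 : ℝ) < k := Nat.cast_pos.2 hk
  have hwindow := sum_le_sum_add_of_window hC h.slope_nonneg h.slope_le h.value_nonneg
    h.value_add_le (fun s => Finset.sum_nonneg fun j _ => add_nonneg (Finset.sum_nonneg fun x _ =>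
      mul_nonneg (h.weight_nonneg x _) (sub_nonneg.2 (h.value_le x _))) (h.regret_nonneg _))
    (h.sum_window_error_le hkN hgap hR) hk hkN (h.sum_slope_sub_le · k)
  have hboundary : (∑ r ∈ Finset.range N, m r + ∑ r ∈ Finset.range N, U r) / k ≤ δ * N ^ 2 := by
    rw [div_le_iff₀ hk0]
    nlinarith [h.sum_slope_le N, h.sum_value_le N, sq_nonneg (N : ℝ)]
  have hgapregret : 2 * N * (k * (δ * k * (2 * N) + 2 * δ * k * N)) / (k : ℝ) ^ 2 =
      8 * δ * N ^ 2 := by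
    field_simp
    ring
  have hdrift : 4 * N * C * k ≤ 8 * C * δ * N ^ 2 := by
    calc 4 * N * C * k ≤ 4 * N * C * (δ * (2 * N)) := by gcongr
      _ = 8 * C * δ * N ^ 2 := by ring
  linarith

/-- The reverse of the trivial inequality between the two sums, which holds because `U r ≤ r * v`
and `r * v ≤ m r`. -/
lemma eventually_sum_slope_le (h : IsSelfPlay d w U m C v) {ε : ℝ} (hε : 0 < ε) :
    ∀ᶠ N : ℕ in atTop,
      ∑ r ∈ Finset.range N, m r ≤ ∑ r ∈ Finset.range N, U r + ε * N ^ 2 := by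
  have hC := h.const_nonneg
  obtain ⟨δ, hδ, hδ2, hδε⟩ : ∃ δ > (0 : ℝ), 2 * δ ≤ 1 ∧ (8 * C + 9) * δ ≤ ε := by
    refine ⟨min (1 / 2) (ε / (8 * C + 9)), by positivity, ?_, ?_⟩
    · linarith [min_le_left (1 / 2) (ε / (8 * C + 9))]
    · rw [← le_div_iff₀' (by positivity)]
      exact min_le_right _ _
  obtain ⟨c, hc, hscale⟩ := eventually_exists_scale_forall_sum_mul_shift_le h.abs_gap_sub_le
    (fun x r => sub_nonneg.2 (h.value_le x r)) h.weight_nonneg h.weight_le_one h.weight_mul_gap hδ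
  have htwo : Tendsto (fun N : ℕ => 2 * N) atTop atTop := tendsto_id.const_mul_atTop' two_pos
  filter_upwards [htwo.eventually hscale,
    htwo.eventually (h.sum_regret.bound (mul_pos hc hδ)), eventually_gt_atTop 0,
    tendsto_natCast_atTop_atTop.eventually_ge_atTop (C / (c * δ))]
    with N ⟨k, hck, hkδ, hgap⟩ hregret hN hNC
  rw [Nat.cast_mul, Nat.cast_ofNat] at hck hkδ hgap hregret
  have hN0 : (0 : ℝ) < N := Nat.cast_pos.2 hN
  have hk0 : (0 : ℝ) < k := (by positivity : 0 < c * (2 * N)).trans_le hck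
  have hkN : k ≤ N := by
    rw [← Nat.cast_le (α := ℝ)]
    nlinarith
  have hCk : 2 * C ≤ δ * k := by
    rw [div_le_iff₀ (by positivity)] at hNC
    nlinarith
  have hR : ∑ i ∈ Finset.range (2 * N), regret d w m i ≤ 2 * δ * k * N := by
    rw [Real.norm_of_nonneg (Finset.sum_nonneg fun i _ => h.regret_nonneg i),
      Real.norm_of_nonneg (by positivity)] at hregret
    calc _ ≤ c * δ * (2 * N) ^ 2 := hregret
      _ = 2 * δ * (c * (2 * N)) * N := by ring
      _ ≤ 2 * δ * k * N := by gcongr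
  refine (h.sum_slope_le_of_scale (Nat.cast_pos.1 hk0) hkN hkδ hCk hgap hR).trans ?_
  gcongr

lemma sum_mul_payoff_eq (d w : X → ℕ → ℝ) (m : ℕ → ℝ) (N : ℕ) :
    ∑ x, (∑ i ∈ Finset.range N, w x i) * d x N =
      ∑ r ∈ Finset.range N, (m r - regret d w m r) +
        ∑ r ∈ Finset.range N, ∑ x, w x r * d x (r + 1) := by
  induction N with
  | zero => simp
  | succ N ih =>
    rw [Finset.sum_range_succ, Finset.sum_range_succ, add_add_add_comm, ← ih, regret,
      sub_sub_cancel, ← Finset.sum_add_distrib, ← Finset.sum_add_distrib]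
    refine Finset.sum_congr rfl fun x _ => ?_
    rw [Finset.sum_range_succ]
    ring

lemma le_sum_mul_payoff (h : IsSelfPlay d w U m C v) (N : ℕ) :
    ∑ r ∈ Finset.range N, m r - ∑ r ∈ Finset.range N, regret d w m r +
      ∑ r ∈ Finset.range N, U r ≤ ∑ x, (∑ i ∈ Finset.range N, w x i) * d x N := by
  rw [sum_mul_payoff_eq d w m N, Finset.sum_sub_distrib]
  gcongr with r
  exact (h.value_le_value_add r 1).trans (h.le_sum_weight_mul_payoff r (r + 1))

lemma sum_mul_payoff_le (h : IsSelfPlay d w U m C v) (N : ℕ) :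
    ∑ x, (∑ i ∈ Finset.range N, w x i) * d x N ≤
      ∑ r ∈ Finset.range N, m r + ∑ r ∈ Finset.range N, U r + C * N := by
  rw [sum_mul_payoff_eq d w m N, add_assoc]
  refine add_le_add (Finset.sum_le_sum fun r _ => sub_le_self _ (h.regret_nonneg r)) ?_
  calc ∑ r ∈ Finset.range N, ∑ x, w x r * d x (r + 1)
      ≤ ∑ r ∈ Finset.range N, (U r + C) := by
        refine Finset.sum_le_sum fun r _ => ?_
        calc ∑ x, w x r * d x (r + 1) ≤ ∑ x, w x r * (d x r + C) :=
              Finset.sum_le_sum fun x _ => mul_le_mul_of_nonneg_left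
                (by simpa using h.payoff_add_le x r 1) (h.weight_nonneg x r)
          _ = U r + C := by
              simp only [mul_add, Finset.sum_add_distrib, ← Finset.sum_mul, h.sum_weight,
                h.sum_weight_mul_payoff, one_mul]
    _ = ∑ r ∈ Finset.range N, U r + C * N := by simp [Finset.sum_add_distrib, mul_comm]

theorem tendsto_payoff (h : IsSelfPlay d w U m C v) :
    Tendsto (fun N : ℕ => (∑ x, (∑ i ∈ Finset.range N, w x i) * d x N) / (N : ℝ) ^ 2) atTop
      (𝓝 v) := by
  have hC := h.const_nonneg
  refine Metric.tendsto_nhds.2 fun ε hε => ?_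
  have hε4 : 0 < ε / 4 := by positivity
  filter_upwards [h.eventually_sum_slope_le hε4, h.sum_regret.bound hε4, eventually_gt_atTop 0,
    tendsto_natCast_atTop_atTop.eventually_ge_atTop ((|v| + C) / (ε / 4))]
    with N hreverse hregret hN hNlarge
  rw [div_le_iff₀ hε4] at hNlarge
  rw [Real.norm_of_nonneg (Finset.sum_nonneg fun r _ => h.regret_nonneg r),
    Real.norm_of_nonneg (by positivity)] at hregret
  have hslope : N * (N - 1) / 2 * v ≤ ∑ r ∈ Finset.range N, m r := by
    rw [← sum_range_cast, Finset.sum_mul]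
    exact Finset.sum_le_sum fun r _ => h.le_slope r
  have hvalue : ∑ r ∈ Finset.range N, U r ≤ N * (N - 1) / 2 * v := by
    rw [← sum_range_cast, Finset.sum_mul]
    exact Finset.sum_le_sum fun r _ => h.value_le_mul r
  have hlow := h.le_sum_mul_payoff N
  have hup := h.sum_mul_payoff_le N
  have hlinear : (|v| + C) * N ≤ ε / 4 * N ^ 2 := by nlinarith
  have hv : |N * v| = |v| * N := by rw [abs_mul, Nat.abs_cast, mul_comm]
  rw [Real.dist_eq, div_sub' (by positivity), abs_div, abs_of_pos (by positivity : (0 : ℝ) < N ^ 2),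
    div_lt_iff₀ (by positivity), abs_lt]
  have hεN : 0 < ε / 4 * N ^ 2 := by positivity
  have hCN : 0 ≤ C * N := by positivity
  constructor <;> linarith [abs_le.1 hv.le]

end IsSelfPlay

end SelfPlay

section Scenario

variable {E ι : Type*} [NormedAddCommGroup E] [NormedSpace ℝ E] [Fintype ι]

/-- `D` is, on the nonnegative orthant, the minimum of the linear forms `p ↦ p ⬝ᵥ φ u` over a
compact set of `u`, where `φ` is nonnegative and convex, and each of its coordinates is strictly
convex between points at which it takes different values. This last condition, weaker than strict
convexity, leaves room for coordinates that do not determine `u`. -/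
structure IsScenario (U : Set E) (φ : E → ι → ℝ) (D : (ι → ℝ) → ℝ) : Prop where
  isCompact : IsCompact U
  nonempty : U.Nonempty
  continuousOn_cost : ContinuousOn φ U
  cost_nonneg : ∀ u ∈ U, 0 ≤ φ u
  convexOn : ConvexOn ℝ U φ
  midpoint_lt : ∀ u ∈ U, ∀ u' ∈ U, ∀ i, φ u i ≠ φ u' i →
    φ ((1 / 2 : ℝ) • u + (1 / 2 : ℝ) • u') i < (φ u i + φ u' i) / 2
  eq_sInf : ∀ p, 0 ≤ p → D p = sInf ((fun u => p ⬝ᵥ φ u) '' U)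

lemma exists_pos_midpoint_add_le {U : Set E} {f : E → ℝ} (hU : IsCompact U) (hconv : Convex ℝ U)
    (hf : ContinuousOn f U)
    (hlt : ∀ u ∈ U, ∀ u' ∈ U, f u ≠ f u' →
      f ((1 / 2 : ℝ) • u + (1 / 2 : ℝ) • u') < (f u + f u') / 2)
    {δ : ℝ} (hδ : 0 < δ) :
    ∃ κ > 0, ∀ u ∈ U, ∀ u' ∈ U, f u' + δ ≤ f u →
      f ((1 / 2 : ℝ) • u + (1 / 2 : ℝ) • u') + κ ≤ (f u + f u') / 2 := by
  have hfst : ContinuousOn (fun z : E × E => f z.1) (U ×ˢ U) :=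
    hf.comp continuousOn_fst fun z hz => hz.1
  have hsnd : ContinuousOn (fun z : E × E => f z.2) (U ×ˢ U) :=
    hf.comp continuousOn_snd fun z hz => hz.2
  have hmid : ContinuousOn (fun z : E × E => f ((1 / 2 : ℝ) • z.1 + (1 / 2 : ℝ) • z.2))
      (U ×ˢ U) :=
    hf.comp (by fun_prop) fun z hz =>
      hconv hz.1 hz.2 one_half_pos.le one_half_pos.le (add_halves 1)
  have hcompact : IsCompact ((U ×ˢ U) ∩ (fun z => f z.1 - f z.2) ⁻¹' Set.Ici δ) :=
    (hU.prod hU).of_isClosed_subset ((hfst.sub hsnd).preimage_isClosed_of_isClosed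
      (hU.prod hU).isClosed isClosed_Ici) Set.inter_subset_left
  obtain ⟨κ, hκ, hle⟩ := hcompact.exists_forall_le' (a := 0)
    ((((hfst.add hsnd).div_const 2).sub hmid).mono Set.inter_subset_left) fun z hz =>
      sub_pos.2 (hlt z.1 hz.1.1 z.2 hz.1.2 (sub_pos.1 (hδ.trans_le hz.2)).ne')
  exact ⟨κ, hκ, fun u hu u' hu' hle' =>
    le_sub_iff_add_le'.1 (hle (u, u') ⟨⟨hu, hu'⟩, le_sub_iff_add_le'.2 hle'⟩)⟩

namespace IsScenario

variable {U : Set E} {φ : E → ι → ℝ} {D : (ι → ℝ) → ℝ}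

lemma exists_isLeast (h : IsScenario U φ D) {p : ι → ℝ} (hp : 0 ≤ p) :
    ∃ u ∈ U, D p = p ⬝ᵥ φ u ∧ ∀ u' ∈ U, D p ≤ p ⬝ᵥ φ u' := by
  have hcont : ContinuousOn (fun u => p ⬝ᵥ φ u) U :=
    (by fun_prop : Continuous fun f : ι → ℝ => p ⬝ᵥ f).comp_continuousOn h.continuousOn_cost
  obtain ⟨u, hu, hmin⟩ := h.isCompact.exists_isMinOn h.nonempty hcont
  have hleast : IsLeast ((fun u => p ⬝ᵥ φ u) '' U) (p ⬝ᵥ φ u) :=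
    ⟨Set.mem_image_of_mem _ hu, by rintro _ ⟨u', hu', rfl⟩; exact hmin hu'⟩
  have heq : D p = p ⬝ᵥ φ u := by rw [h.eq_sInf p hp, hleast.csInf_eq]
  exact ⟨u, hu, heq, fun u' hu' => heq.le.trans (hmin hu')⟩

lemma exists_eq (h : IsScenario U φ D) {p : ι → ℝ} (hp : 0 ≤ p) : ∃ u ∈ U, D p = p ⬝ᵥ φ u :=
  (h.exists_isLeast hp).imp fun _ hu => ⟨hu.1, hu.2.1⟩

lemma le_dotProduct (h : IsScenario U φ D) {p : ι → ℝ} (hp : 0 ≤ p) {u : E} (hu : u ∈ U) :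
    D p ≤ p ⬝ᵥ φ u := by
  obtain ⟨-, -, -, hle⟩ := h.exists_isLeast hp
  exact hle u hu

lemma eventually_cost_le (h : IsScenario U φ D) :
    ∀ᶠ C : ℝ in atTop, ∀ u ∈ U, ∀ i, φ u i ≤ C := by
  obtain ⟨B, hB⟩ := h.isCompact.exists_bound_of_continuousOn h.continuousOn_cost
  filter_upwards [eventually_ge_atTop B] with C hC u hu i
  exact (le_abs_self _).trans ((norm_le_pi_norm (φ u) i).trans ((hB u hu).trans hC))

lemma nonneg (h : IsScenario U φ D) {p : ι → ℝ} (hp : 0 ≤ p) : 0 ≤ D p := by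
  obtain ⟨u, hu, heq⟩ := h.exists_eq hp
  exact heq ▸ dotProduct_nonneg_of_nonneg hp (h.cost_nonneg u hu)

lemma map_smul (h : IsScenario U φ D) {p : ι → ℝ} (hp : 0 ≤ p) {c : ℝ} (hc : 0 ≤ c) :
    D (c • p) = c * D p := by
  obtain ⟨u, hu, heq⟩ := h.exists_eq hp
  obtain ⟨u', hu', heq'⟩ := h.exists_eq (smul_nonneg hc hp)
  refine le_antisymm ?_ ?_
  · simpa [heq] using h.le_dotProduct (smul_nonneg hc hp) hu
  · rw [heq', smul_dotProduct, smul_eq_mul]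
    exact mul_le_mul_of_nonneg_left (h.le_dotProduct hp hu') hc

lemma add_le_map_add (h : IsScenario U φ D) {p q : ι → ℝ} (hp : 0 ≤ p) (hq : 0 ≤ q) :
    D p + D q ≤ D (p + q) := by
  obtain ⟨u, hu, heq⟩ := h.exists_eq (add_nonneg hp hq)
  rw [heq, add_dotProduct]
  exact add_le_add (h.le_dotProduct hp hu) (h.le_dotProduct hq hu)

lemma concaveOn (h : IsScenario U φ D) : ConcaveOn ℝ (Set.Ici 0) D := by
  refine ⟨convex_Ici 0, fun p hp q hq a b ha hb _ => ?_⟩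
  rw [smul_eq_mul, smul_eq_mul, ← h.map_smul hp ha, ← h.map_smul hq hb]
  exact h.add_le_map_add (smul_nonneg ha hp) (smul_nonneg hb hq)

lemma map_le_map_add (h : IsScenario U φ D) {p q : ι → ℝ} (hp : 0 ≤ p) (hq : 0 ≤ q) :
    D p ≤ D (p + q) :=
  (le_add_of_nonneg_right (h.nonneg hq)).trans (h.add_le_map_add hp hq)

lemma le_add_sum_abs (h : IsScenario U φ D) {C : ℝ} (hC : ∀ u ∈ U, ∀ i, φ u i ≤ C)
    {p q : ι → ℝ} (hp : 0 ≤ p) (hq : 0 ≤ q) : D q ≤ D p + C * ∑ i, |q i - p i| := by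
  obtain ⟨u, hu, heq⟩ := h.exists_eq hp
  have hdiff : (q - p) ⬝ᵥ φ u ≤ C * ∑ i, |q i - p i| := by
    rw [dotProduct, Finset.mul_sum]
    refine Finset.sum_le_sum fun i _ => ?_
    rw [mul_comm C]
    exact mul_le_mul (le_abs_self _) (hC u hu i) (h.cost_nonneg u hu i) (abs_nonneg _)
  rw [sub_dotProduct] at hdiff
  linarith [h.le_dotProduct hq hu]

lemma map_add_le (h : IsScenario U φ D) {C : ℝ} (hC : ∀ u ∈ U, ∀ i, φ u i ≤ C)
    {p q : ι → ℝ} (hp : 0 ≤ p) (hq : 0 ≤ q) : D (p + q) ≤ D p + C * ∑ i, q i := by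
  simpa [abs_of_nonneg (hq _)] using h.le_add_sum_abs hC hp (add_nonneg hp hq)

lemma continuousOn (h : IsScenario U φ D) : ContinuousOn D (Set.Ici 0) := by
  obtain ⟨C, hC⟩ := h.eventually_cost_le.exists
  intro p hp
  have hlim : Tendsto (fun q : ι → ℝ => C * ∑ i, |q i - p i|) (𝓝[Set.Ici 0] p) (𝓝 0) := by
    have hcont : Continuous fun q : ι → ℝ => C * ∑ i, |q i - p i| := by fun_prop
    simpa using (hcont.tendsto p).mono_left nhdsWithin_le_nhds
  refine tendsto_iff_dist_tendsto_zero.2 (squeeze_zero' (Eventually.of_forall fun _ => dist_nonneg)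
    ?_ hlim)
  filter_upwards [self_mem_nhdsWithin] with q hq
  have hqp := h.le_add_sum_abs hC hp hq
  have hpq := h.le_add_sum_abs hC hq hp
  simp only [abs_sub_comm (p _)] at hpq
  rw [Real.dist_eq, abs_le]
  constructor <;> linarith

lemma dotProduct_midpoint_add_le (h : IsScenario U φ D) {p : ι → ℝ} (hp : 0 ≤ p) {u u' : E}
    (hu : u ∈ U) (hu' : u' ∈ U) {i : ι} {κ : ℝ}
    (hκ : φ ((1 / 2 : ℝ) • u + (1 / 2 : ℝ) • u') i + κ ≤ (φ u i + φ u' i) / 2) :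
    p ⬝ᵥ φ ((1 / 2 : ℝ) • u + (1 / 2 : ℝ) • u') + p i * κ ≤ (p ⬝ᵥ φ u + p ⬝ᵥ φ u') / 2 := by
  classical
  have hle : φ ((1 / 2 : ℝ) • u + (1 / 2 : ℝ) • u') + Pi.single i κ ≤
      (1 / 2 : ℝ) • (φ u + φ u') := by
    intro j
    rcases eq_or_ne j i with rfl | hj
    · simp only [Pi.add_apply, Pi.single_eq_same, Pi.smul_apply, smul_eq_mul]
      linarith
    · simpa [hj, mul_add] using
        h.convexOn.2 hu hu' one_half_pos.le one_half_pos.le (add_halves 1) j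
  have hdot := dotProduct_le_dotProduct_of_nonneg_left hle hp
  rw [dotProduct_add, dotProduct_single, dotProduct_smul, dotProduct_add, smul_eq_mul] at hdot
  linarith

/-- Stability of minimizers: at the midpoint of two near-minimizers with different costs in
coordinate `i`, strict convexity would gain a fixed multiple of the weight of `i`. -/
lemma eventually_cost_le_add (h : IsScenario U φ D) {δ : ℝ} (hδ : 0 < δ) (B : ℝ) (i : ι) :
    ∀ᶠ L : ℝ in atTop, ∀ p q : ι → ℝ, 0 ≤ p → 0 ≤ q → ∑ j, q j ≤ B → L ≤ p i →
      ∀ u ∈ U, ∀ u' ∈ U, D p = p ⬝ᵥ φ u → D (p + q) = (p + q) ⬝ᵥ φ u' →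
        φ u i ≤ φ u' i + δ := by
  obtain ⟨C, hC, hC0⟩ := (h.eventually_cost_le.and (eventually_ge_atTop 0)).exists
  obtain ⟨κ, hκ, hmid⟩ := exists_pos_midpoint_add_le h.isCompact h.convexOn.1
    ((continuous_apply i).comp_continuousOn h.continuousOn_cost)
    (fun u hu u' hu' => h.midpoint_lt u hu u' hu' i) hδ
  filter_upwards [eventually_gt_atTop (B * C / κ), eventually_ge_atTop 0]
    with L hL hL0 p q hp hq hqB hLp u hu u' hu' heq heq'
  by_contra! hlt
  have hgain := h.dotProduct_midpoint_add_le hp hu hu' (hmid u hu u' hu' hlt.le)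
  have hmin := h.le_dotProduct hp
    (h.convexOn.1 hu hu' one_half_pos.le one_half_pos.le (add_halves 1))
  have hmin' := h.le_dotProduct (add_nonneg hp hq) hu
  rw [heq', add_dotProduct, add_dotProduct] at hmin'
  have hqu : q ⬝ᵥ φ u ≤ B * C := by
    calc q ⬝ᵥ φ u ≤ ∑ j, q j * C :=
          Finset.sum_le_sum fun j _ => mul_le_mul_of_nonneg_left (hC u hu j) (hq j)
      _ ≤ B * C := by rw [← Finset.sum_mul]; exact mul_le_mul_of_nonneg_right hqB hC0
  have hqu' : 0 ≤ q ⬝ᵥ φ u' := dotProduct_nonneg_of_nonneg hq (h.cost_nonneg u' hu')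
  have hpκ : B * C < p i * κ := by
    rw [div_lt_iff₀ hκ] at hL
    exact hL.trans_le (mul_le_mul_of_nonneg_right hLp hκ.le)
  linarith [mul_nonneg (hL0.trans hLp) hκ.le]

end IsScenario

end Scenario

section Supergradients

variable {ι X : Type*} [Fintype ι] {F : (ι → ℝ) → (X → ℝ) → ℝ} {μ : X → ℝ}

/-- The supergradients at `p` of a concave function on the nonnegative orthant that is homogeneous
of degree one, with coordinates at most `C`. Homogeneity makes the supporting affine function
linear. -/
def boundedSupergradient (G : (ι → ℝ) → ℝ) (C : ℝ) (p : ι → ℝ) : Set (ι → ℝ) :=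
  {f | (∀ p', 0 ≤ p' → G p' ≤ p' ⬝ᵥ f) ∧ G p = p ⬝ᵥ f ∧ ∀ i, f i ≤ C}

lemma convex_boundedSupergradient (G : (ι → ℝ) → ℝ) (C : ℝ) (p : ι → ℝ) :
    Convex ℝ (boundedSupergradient G C p) := by
  have hlin : ∀ p' : ι → ℝ, IsLinearMap ℝ fun f => p' ⬝ᵥ f := fun p' =>
    ⟨dotProduct_add p', fun c => dotProduct_smul c p'⟩
  have hset : boundedSupergradient G C p =
      (⋂ p', ⋂ (_ : 0 ≤ p'), {f | G p' ≤ p' ⬝ᵥ f}) ∩ ({f | p ⬝ᵥ f = G p} ∩ Set.Iic fun _ => C) := by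
    ext f
    simp [boundedSupergradient, Pi.le_def, eq_comm]
  rw [hset]
  exact (convex_iInter₂ fun p' _ => convex_halfSpace_ge (hlin p') _).inter
    ((convex_hyperplane (hlin p) _).inter (convex_Iic _))

lemma tendsto_quotient_gradP {p v : ι → ℝ} (hd : DifferentiableInP F p μ) (hp : 0 ≤ p)
    (hv : 0 ≤ p + v) :
    Tendsto (fun t : ℝ => (F (p + t • v) μ - F p μ) / t) (𝓝[>] 0) (𝓝 (v ⬝ᵥ gradP F p μ)) := by
  classical
  have hgrad : fderivWithin ℝ (fun p' => F p' μ) (Set.Ici 0) p v = v ⬝ᵥ gradP F p μ := by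
    conv_lhs => rw [pi_eq_sum_univ' v]
    simp only [map_sum, map_smul, smul_eq_mul, dotProduct, gradP]
  have hline : HasDerivWithinAt (fun t : ℝ => p + t • v) v (Set.Icc 0 1) 0 := by
    simpa using (((hasDerivAt_id (0 : ℝ)).smul_const v).const_add p).hasDerivWithinAt
  have hmaps : Set.MapsTo (fun t : ℝ => p + t • v) (Set.Icc 0 1) (Set.Ici 0) := fun t ht => by
    simpa using (convex_Ici (0 : ι → ℝ)).add_smul_sub_mem hp hv ht
  have hderiv : HasFDerivWithinAt (fun p' => F p' μ)
      (fderivWithin ℝ (fun p' => F p' μ) (Set.Ici 0) p) (Set.Ici 0) (p + (0 : ℝ) • v) := by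
    simpa using DifferentiableWithinAt.hasFDerivWithinAt hd
  have hslope := hderiv.comp_hasDerivWithinAt (0 : ℝ) hline hmaps
  rw [hgrad, hasDerivWithinAt_iff_tendsto_slope] at hslope
  have hnhds : 𝓝[>] (0 : ℝ) ≤ 𝓝[Set.Icc 0 1 \ {0}] 0 := by
    rw [← nhdsWithin_Ioc_eq_nhdsGT (zero_lt_one' ℝ)]
    exact nhdsWithin_mono _ fun t ht => ⟨⟨ht.1.le, ht.2⟩, ht.1.ne'⟩
  refine (hslope.mono_left hnhds).congr fun t => ?_
  simp [slope_def_field]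

lemma sub_le_dotProduct_gradP (hF : ConcaveOn ℝ (Set.Ici 0) fun p => F p μ) {p p' : ι → ℝ}
    (hd : DifferentiableInP F p μ) (hp : 0 ≤ p) (hp' : 0 ≤ p') :
    F p' μ - F p μ ≤ (p' - p) ⬝ᵥ gradP F p μ := by
  refine ge_of_tendsto (tendsto_quotient_gradP hd hp (by simpa using hp')) ?_
  filter_upwards [Ioc_mem_nhdsGT (zero_lt_one' ℝ)] with t ht
  have hconc := hF.2 hp hp' (sub_nonneg.2 ht.2) ht.1.le (sub_add_cancel 1 t)
  have hseg : p + t • (p' - p) = (1 - t) • p + t • p' := by module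
  rw [le_div_iff₀ ht.1, hseg]
  simp only [smul_eq_mul] at hconc
  linarith

lemma gradP_mem_boundedSupergradient (hF : ConcaveOn ℝ (Set.Ici 0) fun p => F p μ)
    (hhom : ∀ p, 0 ≤ p → ∀ c : ℝ, 0 ≤ c → F (c • p) μ = c * F p μ) {C : ℝ}
    (hC : ∀ p q, 0 ≤ p → 0 ≤ q → F (p + q) μ ≤ F p μ + C * ∑ i, q i) {p : ι → ℝ} (hp : 0 ≤ p)
    (hd : DifferentiableInP F p μ) :
    gradP F p μ ∈ boundedSupergradient (fun p => F p μ) C p := by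
  classical
  -- Euler's identity: the supergradient inequality at `0` and at `2 • p`
  have heuler : F p μ = p ⬝ᵥ gradP F p μ := by
    have hzero := sub_le_dotProduct_gradP hF hd hp le_rfl
    have htwo := sub_le_dotProduct_gradP hF hd hp (smul_nonneg (zero_le_two (α := ℝ)) hp)
    have hF0 : F 0 μ = 0 := by simpa using hhom p hp 0 le_rfl
    rw [hF0, zero_sub, zero_sub, neg_dotProduct] at hzero
    rw [hhom p hp 2 zero_le_two, sub_dotProduct, smul_dotProduct, smul_eq_mul] at htwo
    linarith
  refine ⟨fun p' hp' => ?_, heuler, fun i => ?_⟩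
  · have hsup := sub_le_dotProduct_gradP hF hd hp hp'
    rw [sub_dotProduct, ← heuler] at hsup
    linarith
  · have hlim := tendsto_quotient_gradP hd hp (v := Pi.single i 1)
      (add_nonneg hp (Pi.single_nonneg.2 zero_le_one))
    rw [single_one_dotProduct] at hlim
    refine le_of_tendsto hlim ?_
    filter_upwards [self_mem_nhdsWithin] with t (ht : 0 < t)
    have hstep := hC p (t • Pi.single i 1) hp
      (smul_nonneg ht.le (Pi.single_nonneg.2 zero_le_one))
    rw [← Pi.single_smul, smul_eq_mul, mul_one, Fintype.sum_pi_single'] at hstep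
    rw [div_le_iff₀ ht, ← Pi.single_smul, smul_eq_mul, mul_one]
    linarith

end Supergradients

/-- The payoff `∑ x, μ x * D x p` of the game in which the second player chooses between the
payoff functions `D x`. -/
def mixedPayoff {ι X : Type*} [Fintype X] (D : X → (ι → ℝ) → ℝ) (p : ι → ℝ) (μ : X → ℝ) : ℝ :=
  ∑ x, μ x * D x p

lemma gradMu_mixedPayoff {ι X : Type*} [Fintype X] (D : X → (ι → ℝ) → ℝ) (p : ι → ℝ)
    (μ : X → ℝ) : gradMu (mixedPayoff D) p μ = fun x => D x p := by
  classical
  have hlin : mixedPayoff D p =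
      ∑ x, D x p • ContinuousLinearMap.proj (R := ℝ) (φ := fun _ : X => ℝ) x := by
    ext μ'
    simp [mixedPayoff, mul_comm]
  ext x
  rw [gradMu, hlin, ContinuousLinearMap.fderiv]
  simp [Pi.single_apply]

section MixedPayoff

variable {E ι X : Type*} [NormedAddCommGroup E] [NormedSpace ℝ E] [Fintype ι] [Fintype X]
  {U : X → Set E} {φ : X → E → ι → ℝ} {D : X → (ι → ℝ) → ℝ} {μ : X → ℝ}

lemma mixedPayoff_smul (h : ∀ x, IsScenario (U x) (φ x) (D x)) (μ : X → ℝ) {p : ι → ℝ}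
    (hp : 0 ≤ p) {c : ℝ} (hc : 0 ≤ c) : mixedPayoff D (c • p) μ = c * mixedPayoff D p μ := by
  simp only [mixedPayoff, (h _).map_smul hp hc, Finset.mul_sum, mul_left_comm c]

lemma concaveOn_mixedPayoff (h : ∀ x, IsScenario (U x) (φ x) (D x)) (hμ : 0 ≤ μ) :
    ConcaveOn ℝ (Set.Ici 0) fun p => mixedPayoff D p μ := by
  refine ⟨convex_Ici 0, fun p hp q hq a b ha hb hab => ?_⟩
  simp only [mixedPayoff, smul_eq_mul, Finset.mul_sum, ← Finset.sum_add_distrib]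
  refine Finset.sum_le_sum fun x _ => ?_
  have hconc := mul_le_mul_of_nonneg_left ((h x).concaveOn.2 hp hq ha hb hab) (hμ x)
  simp only [smul_eq_mul] at hconc
  linarith

lemma continuousOn_mixedPayoff (h : ∀ x, IsScenario (U x) (φ x) (D x)) (μ : X → ℝ) :
    ContinuousOn (fun p => mixedPayoff D p μ) (Set.Ici 0) :=
  continuousOn_finsetSum _ fun x _ => (h x).continuousOn.const_mul (μ x)

lemma mixedPayoff_add_le (h : ∀ x, IsScenario (U x) (φ x) (D x)) {C : ℝ}
    (hC : ∀ x, ∀ u ∈ U x, ∀ i, φ x u i ≤ C) (hμ : μ ∈ stdSimplex ℝ X) {p q : ι → ℝ} (hp : 0 ≤ p)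
    (hq : 0 ≤ q) : mixedPayoff D (p + q) μ ≤ mixedPayoff D p μ + C * ∑ i, q i := by
  calc mixedPayoff D (p + q) μ ≤ ∑ x, μ x * (D x p + C * ∑ i, q i) :=
        Finset.sum_le_sum fun x _ => mul_le_mul_of_nonneg_left ((h x).map_add_le (hC x) hp hq)
          (hμ.1 x)
    _ = mixedPayoff D p μ + C * ∑ i, q i := by
        simp only [mul_add, Finset.sum_add_distrib, ← Finset.sum_mul, hμ.2, one_mul, mixedPayoff]

lemma mem_boundedSupergradient_of_tendsto (h : ∀ x, IsScenario (U x) (φ x) (D x)) {C : ℝ}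
    {ps fs : ℕ → ι → ℝ} {μs : ℕ → X → ℝ} {p f : ι → ℝ} (hp : 0 ≤ p) (hps0 : ∀ n, 0 ≤ ps n)
    (hps : Tendsto ps atTop (𝓝 p)) (hμs : Tendsto μs atTop (𝓝 μ)) (hfs : Tendsto fs atTop (𝓝 f))
    (hmem : ∀ n, fs n ∈ boundedSupergradient (fun p => mixedPayoff D p (μs n)) C (ps n)) :
    f ∈ boundedSupergradient (fun p => mixedPayoff D p μ) C p := by
  have hD : ∀ x, Tendsto (fun n => D x (ps n)) atTop (𝓝 (D x p)) := fun x =>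
    ((h x).continuousOn p hp).tendsto.comp
      (tendsto_nhdsWithin_iff.2 ⟨hps, Eventually.of_forall hps0⟩)
  have hμ := tendsto_pi_nhds.1 hμs
  have hf := tendsto_pi_nhds.1 hfs
  refine ⟨fun p' hp' => ?_, ?_, fun i => le_of_tendsto' (hf i) fun n => (hmem n).2.2 i⟩
  · exact le_of_tendsto_of_tendsto' (tendsto_finsetSum _ fun x _ => (hμ x).mul_const (D x p'))
      (tendsto_finsetSum _ fun i _ => (hf i).const_mul (p' i)) fun n => (hmem n).1 p' hp'
  · refine tendsto_nhds_unique (tendsto_finsetSum _ fun x _ => (hμ x).mul (hD x))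
      ((tendsto_finsetSum _ fun i _ => (tendsto_pi_nhds.1 hps i).mul (hf i)).congr fun n => ?_)
    exact (hmem n).2.1.symm

lemma clarkeGrad_subset_boundedSupergradient (h : ∀ x, IsScenario (U x) (φ x) (D x)) {C : ℝ}
    (hC : ∀ x, ∀ u ∈ U x, ∀ i, φ x u i ≤ C) {p : ι → ℝ} (hp : 0 ≤ p) :
    clarkeGrad (mixedPayoff D) p μ ⊆ boundedSupergradient (fun p => mixedPayoff D p μ) C p := by
  refine convexHull_min ?_ (convex_boundedSupergradient _ C p)
  rintro f ⟨ps, μs, hmem, hps, hμs, hfs⟩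
  refine mem_boundedSupergradient_of_tendsto h hp (fun n => (hmem n).1.1) hps hμs hfs fun n => ?_
  exact gradP_mem_boundedSupergradient (concaveOn_mixedPayoff h (hmem n).2.1.1)
    (fun p hp c hc => mixedPayoff_smul h _ hp hc)
    (fun p q hp hq => mixedPayoff_add_le h hC (hmem n).2.1 hp hq) (hmem n).1.1 (hmem n).2.2

end MixedPayoff

lemma weight_mul_gradMu_sub_eq_zero {ι X : Type*} [Fintype X] {F : (ι → ℝ) → (X → ℝ) → ℝ}
    {p : ι → ℝ} {μ w : X → ℝ} (hw : w ∈ lmoMu F p μ) {x₀ : X}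
    (hx₀ : ∀ x, gradMu F p μ x₀ ≤ gradMu F p μ x) (x : X) :
    w x * (gradMu F p μ x - gradMu F p μ x₀) = 0 := by
  classical
  have hnonneg : ∀ y ∈ Finset.univ, 0 ≤ w y * (gradMu F p μ y - gradMu F p μ x₀) := fun y _ =>
    mul_nonneg (hw.1.1 y) (sub_nonneg.2 (hx₀ y))
  have hopt := hw.2 _ (single_mem_stdSimplex ℝ x₀)
  rw [single_one_dotProduct] at hopt
  have hsum : ∑ y, w y * (gradMu F p μ y - gradMu F p μ x₀) ≤ 0 := by
    simp only [mul_sub, Finset.sum_sub_distrib]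
    rw [← Finset.sum_mul, hw.1.2, one_mul]
    exact sub_nonpos.2 hopt
  exact (Finset.sum_eq_zero_iff_of_nonneg hnonneg).1
    (hsum.antisymm (Finset.sum_nonneg hnonneg)) x (Finset.mem_univ x)

section LinearOracles

variable {ι X : Type*} [Fintype ι] [Fintype X] {F : (ι → ℝ) → (X → ℝ) → ℝ} {p q : ι → ℝ}
  {μ : X → ℝ}

lemma dotProduct_le_sum_mul {f : ι → ℝ} {a : ℝ} (hq : 0 ≤ q) (hf : ∀ i, f i ≤ a) :
    q ⬝ᵥ f ≤ (∑ i, q i) * a := by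
  rw [Finset.sum_mul]
  exact Finset.sum_le_sum fun i _ => mul_le_mul_of_nonneg_left (hf i) (hq i)

lemma boundedSupergradient_subset_smul {G : (ι → ℝ) → ℝ} {C c : ℝ} (hG : G (c • p) = c * G p) :
    boundedSupergradient G C p ⊆ boundedSupergradient G C (c • p) := fun f hf =>
  ⟨hf.1, by rw [hG, smul_dotProduct, hf.2.1, smul_eq_mul], hf.2.2⟩

/-- The payoff of the first player's best response in the linearized game, minimized over the
linearizations in the Clarke gradient. -/
def bestSlope (F : (ι → ℝ) → (X → ℝ) → ℝ) (p : ι → ℝ) (μ : X → ℝ) : ℝ :=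
  sInf {a | ∃ f ∈ clarkeGrad F p μ, ∀ i, f i ≤ a}

lemma mem_stdSimplex_of_mem_lmoP (hq : q ∈ lmoP F p μ) : q ∈ stdSimplex ℝ ι :=
  convexHull_min (fun _ hq' => hq'.1) (convex_stdSimplex ℝ ι) hq

lemma clarkeGrad_nonempty_of_mem_lmoP (hq : q ∈ lmoP F p μ) : (clarkeGrad F p μ).Nonempty := by
  obtain ⟨-, -, f, hf, -⟩ := convexHull_nonempty_iff.1 ⟨q, hq⟩
  exact ⟨f, hf⟩

variable {C : ℝ} {P R : ι → ℝ}

lemma le_of_mem_clarkeGrad (hsub : clarkeGrad F p μ ⊆ boundedSupergradient (fun p => F p μ) C R)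
    (hP : P ∈ stdSimplex ℝ ι) {f : ι → ℝ} (hf : f ∈ clarkeGrad F p μ) {a : ℝ}
    (hfa : ∀ i, f i ≤ a) : F P μ ≤ a := by
  calc F P μ ≤ P ⬝ᵥ f := (hsub hf).1 P hP.1
    _ ≤ (∑ i, P i) * a := dotProduct_le_sum_mul hP.1 hfa
    _ = a := by rw [hP.2, one_mul]

lemma bestSlope_le_of_mem (hsub : clarkeGrad F p μ ⊆ boundedSupergradient (fun p => F p μ) C R)
    (hP : P ∈ stdSimplex ℝ ι) {f : ι → ℝ} (hf : f ∈ clarkeGrad F p μ) {a : ℝ}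
    (hfa : ∀ i, f i ≤ a) : bestSlope F p μ ≤ a :=
  csInf_le ⟨F P μ, fun _ ⟨_, hg, hga⟩ => le_of_mem_clarkeGrad hsub hP hg hga⟩ ⟨f, hf, hfa⟩

lemma le_bestSlope (hsub : clarkeGrad F p μ ⊆ boundedSupergradient (fun p => F p μ) C R)
    (hne : (clarkeGrad F p μ).Nonempty) (hP : P ∈ stdSimplex ℝ ι) : F P μ ≤ bestSlope F p μ := by
  obtain ⟨f, hf⟩ := hne
  exact le_csInf ⟨C, f, hf, (hsub hf).2.2⟩ fun _ ⟨_, hg, hga⟩ => le_of_mem_clarkeGrad hsub hP hg hga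

lemma sub_le_mul_bestSlope
    (hsub : clarkeGrad F p μ ⊆ boundedSupergradient (fun p => F p μ) C P)
    (hne : (clarkeGrad F p μ).Nonempty) (hP : 0 ≤ P) (hq : 0 ≤ q) :
    F (P + q) μ - F P μ ≤ (∑ i, q i) * bestSlope F p μ := by
  obtain ⟨f, hf⟩ := hne
  have hle : ∀ g ∈ clarkeGrad F p μ, ∀ a, (∀ i, g i ≤ a) →
      F (P + q) μ - F P μ ≤ (∑ i, q i) * a := by
    intro g hg a hga
    have hsup := (hsub hg).1 (P + q) (add_nonneg hP hq)
    rw [add_dotProduct, ← (hsub hg).2.1] at hsup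
    linarith [dotProduct_le_sum_mul hq hga]
  rcases (Finset.sum_nonneg fun i _ => hq i : (0 : ℝ) ≤ ∑ i, q i).eq_or_lt with hzero | hpos
  · simpa [← hzero] using hle f hf C (hsub hf).2.2
  · rw [← div_le_iff₀' hpos]
    exact le_csInf ⟨C, f, hf, (hsub hf).2.2⟩ fun a ⟨g, hg, hga⟩ =>
      (div_le_iff₀' hpos).2 (hle g hg a hga)

lemma bestSlope_le_dotProduct
    (hsub : clarkeGrad F p μ ⊆ boundedSupergradient (fun p => F p μ) C R) (hq : q ∈ lmoP F p μ)
    {b : ι → ℝ} (hb : ∀ f ∈ clarkeGrad F p μ, f ≤ b) : bestSlope F p μ ≤ q ⬝ᵥ b := by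
  classical
  have hlin : IsLinearMap ℝ fun q : ι → ℝ => q ⬝ᵥ b :=
    ⟨fun q q' => add_dotProduct q q' b, fun c q => smul_dotProduct c q b⟩
  refine convexHull_min ?_ (convex_halfSpace_ge hlin (bestSlope F p μ)) hq
  rintro q' ⟨hq', f, hf, hmax⟩
  refine (bestSlope_le_of_mem hsub hq' hf fun i => ?_).trans
    (dotProduct_le_dotProduct_of_nonneg_left (hb f hf) hq'.1)
  simpa only [single_one_dotProduct] using hmax _ (single_mem_stdSimplex ℝ i)

end LinearOracles

section Play

variable {κ : Type*} [Fintype κ]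

lemma add_smul_sub_mem_stdSimplex {p q : κ → ℝ} (hp : p ∈ stdSimplex ℝ κ)
    (hq : q ∈ stdSimplex ℝ κ) (n : ℕ) :
    p + (1 / ((n : ℝ) + 1)) • (q - p) ∈ stdSimplex ℝ κ :=
  (convex_stdSimplex ℝ κ).add_smul_sub_mem hp hq
    ⟨by positivity, div_le_one_of_le₀ (by linarith [n.cast_nonneg (α := ℝ)]) (by positivity)⟩

lemma mem_stdSimplex_of_average {p q : ℕ → κ → ℝ} (h0 : p 0 ∈ stdSimplex ℝ κ)
    (hq : ∀ n, q n ∈ stdSimplex ℝ κ)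
    (hstep : ∀ n : ℕ, p (n + 1) = p n + (1 / ((n : ℝ) + 1)) • (q n - p n)) (n : ℕ) :
    p n ∈ stdSimplex ℝ κ := by
  induction n with
  | zero => exact h0
  | succ n ih => exact hstep n ▸ add_smul_sub_mem_stdSimplex ih (hq n) n

lemma smul_eq_sum_of_average {V : Type*} [AddCommGroup V] [Module ℝ V] {p q : ℕ → V}
    (hstep : ∀ n : ℕ, p (n + 1) = p n + (1 / ((n : ℝ) + 1)) • (q n - p n)) (n : ℕ) :
    (n : ℝ) • p n = ∑ i ∈ Finset.range n, q i := by
  induction n with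
  | zero => simp
  | succ n ih =>
    have hn : (n : ℝ) + 1 ≠ 0 := by positivity
    rw [Finset.sum_range_succ, ← ih, hstep, Nat.cast_succ, smul_add, smul_smul,
      mul_one_div_cancel hn]
    module

variable {ι X : Type*} [Fintype ι] [Fintype X]

/-- A run of self-play together with the answers `q n`, `w n` of the oracles, whose averages are
`p n`, `μ n`. -/
structure IsPlay (F : (ι → ℝ) → (X → ℝ) → ℝ) (p q : ℕ → ι → ℝ) (μ w : ℕ → X → ℝ) : Prop where
  p_mem : ∀ n, p n ∈ stdSimplex ℝ ι
  mu_mem : ∀ n, μ n ∈ stdSimplex ℝ X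
  answer_p_mem : ∀ n, q n ∈ lmoP F (p n) (μ n)
  answer_mu_mem : ∀ n, w n ∈ lmoMu F (p n) (μ n)
  smul_p : ∀ n : ℕ, (n : ℝ) • p n = ∑ i ∈ Finset.range n, q i
  smul_mu : ∀ n : ℕ, (n : ℝ) • μ n = ∑ i ∈ Finset.range n, w i

lemma exists_isPlay {F : (ι → ℝ) → (X → ℝ) → ℝ} {p : ℕ → ι → ℝ} {μ : ℕ → X → ℝ}
    (h : IsTrajectory F p μ) : ∃ q w, IsPlay F p q μ w := by
  choose q hq hp using h.step_p
  choose w hw hμ using h.step_mu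
  exact ⟨q, w,
    mem_stdSimplex_of_average h.init_p (fun n => mem_stdSimplex_of_mem_lmoP (hq n)) hp,
    mem_stdSimplex_of_average h.init_mu (fun n => (hw n).1) hμ, hq, hw,
    smul_eq_sum_of_average hp, smul_eq_sum_of_average hμ⟩

end Play

section Regret

variable {E ι X : Type*} [NormedAddCommGroup E] [NormedSpace ℝ E] [Fintype ι]

lemma sub_single_one_nonneg {ι : Type*} [DecidableEq ι] {p : ι → ℝ} (hp : 0 ≤ p) {i : ι}
    (hi : 1 ≤ p i) : 0 ≤ p - Pi.single i 1 := by
  intro j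
  rcases eq_or_ne j i with rfl | hj
  · simpa using hi
  · simpa [hj] using hp j

lemma IsScenario.eventually_sub_le [DecidableEq ι] {U : Set E} {φ : E → ι → ℝ}
    {D : (ι → ℝ) → ℝ} (h : IsScenario U φ D) {δ : ℝ} (hδ : 0 < δ) (B : ℝ) (i : ι) :
    ∀ᶠ L : ℝ in atTop, ∀ p q : ι → ℝ, 0 ≤ p → 0 ≤ q → ∑ j, q j ≤ B → L ≤ p i → ∀ u ∈ U,
      D (p + q) = (p + q) ⬝ᵥ φ u →
        D p - D (p - Pi.single i 1) ≤ φ u i + δ := by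
  have hshift := tendsto_atTop_add_const_right atTop (-1 : ℝ) tendsto_id
  filter_upwards [hshift.eventually (h.eventually_cost_le_add hδ (B + 1) i),
    eventually_ge_atTop 1] with L hL hL1 p q hp hq hqB hLp u hu heq
  have hp' := sub_single_one_nonneg hp (hL1.trans hLp)
  obtain ⟨u', hu', heq'⟩ := h.exists_eq hp'
  have hcost : φ u' i ≤ φ u i + δ := by
    refine hL (p - Pi.single i 1) (q + Pi.single i 1) hp'
      (add_nonneg hq (Pi.single_nonneg.2 zero_le_one)) ?_ ?_ u' hu' u hu heq' ?_
    · simpa [Finset.sum_add_distrib] using hqB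
    · simpa [← sub_eq_add_neg] using hLp
    · rwa [sub_add_add_cancel]
  have hle := h.le_dotProduct hp hu'
  rw [heq', sub_dotProduct, single_one_dotProduct]
  linarith

variable [Fintype X] {U : X → Set E} {φ : X → E → ι → ℝ} {D : X → (ι → ℝ) → ℝ}

lemma eventually_supergradient_le (h : ∀ x, IsScenario (U x) (φ x) (D x)) {δ : ℝ}
    (hδ : 0 < δ) (B C : ℝ) :
    ∀ᶠ L : ℝ in atTop, ∀ p q : ι → ℝ, 0 ≤ p → 0 ≤ q → ∑ j, q j ≤ B →
      ∀ μ ∈ stdSimplex ℝ X, ∀ u : X → E, (∀ x, u x ∈ U x) →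
      (∀ x, D x (p + q) = (p + q) ⬝ᵥ φ x (u x)) →
      ∀ f ∈ boundedSupergradient (fun p => mixedPayoff D p μ) C p, ∀ i, L ≤ p i →
        f i ≤ (∑ x, μ x • φ x (u x)) i + δ := by
  classical
  filter_upwards [eventually_all.2 fun x => eventually_all.2 fun i =>
    (h x).eventually_sub_le hδ B i, eventually_ge_atTop 1]
    with L hL hL1 p q hp hq hqB μ hμ u hu heq f hf i hi
  have hstep := fun x => hL x i p q hp hq hqB hi (u x) (hu x) (heq x)
  have hsup := hf.1 _ (sub_single_one_nonneg hp (hL1.trans hi))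
  rw [sub_dotProduct, single_one_dotProduct, ← hf.2.1] at hsup
  calc f i ≤ mixedPayoff D p μ - mixedPayoff D (p - Pi.single i 1) μ := by linarith
    _ = ∑ x, μ x * (D x p - D x (p - Pi.single i 1)) := by
        simp only [mixedPayoff, mul_sub, Finset.sum_sub_distrib]
    _ ≤ ∑ x, μ x * (φ x (u x) i + δ) :=
        Finset.sum_le_sum fun x _ => mul_le_mul_of_nonneg_left (hstep x) (hμ.1 x)
    _ = (∑ x, μ x • φ x (u x)) i + δ := by
        simp [mul_add, Finset.sum_add_distrib, ← Finset.sum_mul, hμ.2]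

lemma eventually_bestSlope_le (h : ∀ x, IsScenario (U x) (φ x) (D x)) {δ : ℝ} (hδ : 0 < δ)
    (C : ℝ) :
    ∀ᶠ L : ℝ in atTop, ∀ (p q P : ι → ℝ) (μ : X → ℝ), 0 ≤ P → μ ∈ stdSimplex ℝ X →
      clarkeGrad (mixedPayoff D) p μ ⊆ boundedSupergradient (fun p => mixedPayoff D p μ) C P →
      q ∈ lmoP (mixedPayoff D) p μ →
        bestSlope (mixedPayoff D) p μ ≤ mixedPayoff D (P + q) μ - mixedPayoff D P μ + δ +
          C * ∑ i, if P i < L then q i else 0 := by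
  filter_upwards [eventually_supergradient_le h hδ 1 C] with L hL p q P μ hP hμ hsub hq
  have hqs := mem_stdSimplex_of_mem_lmoP hq
  choose u hu heq using fun x => (h x).exists_eq (add_nonneg hP hqs.1)
  set s := ∑ x, μ x • φ x (u x)
  have hs : 0 ≤ s := Finset.sum_nonneg fun x _ => smul_nonneg (hμ.1 x) ((h x).cost_nonneg _ (hu x))
  have hgrad : ∀ f ∈ clarkeGrad (mixedPayoff D) p μ,
      f ≤ fun i => s i + δ + if P i < L then C else 0 := by
    intro f hf i
    dsimp only
    split_ifs with hi
    · have hsi : 0 ≤ s i := hs i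
      linarith [(hsub hf).2.2 i]
    · rw [add_zero]
      exact hL P q hP hqs.1 hqs.2.le μ hμ u hu heq f (hsub hf) i (not_lt.1 hi)
  have hgain : q ⬝ᵥ s ≤ mixedPayoff D (P + q) μ - mixedPayoff D P μ := by
    simp only [s, dotProduct_sum, dotProduct_smul, mixedPayoff, ← Finset.sum_sub_distrib,
      ← mul_sub, smul_eq_mul]
    refine Finset.sum_le_sum fun x _ => mul_le_mul_of_nonneg_left ?_ (hμ.1 x)
    rw [heq x, add_dotProduct]
    linarith [(h x).le_dotProduct hP (hu x)]
  calc bestSlope (mixedPayoff D) p μ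
      ≤ q ⬝ᵥ fun i => s i + δ + if P i < L then C else 0 := bestSlope_le_dotProduct hsub hq hgrad
    _ = q ⬝ᵥ s + δ + C * ∑ i, if P i < L then q i else 0 := by
        simp only [dotProduct, mul_add, Finset.sum_add_distrib, ← Finset.sum_mul, hqs.2, one_mul]
        simp only [Finset.mul_sum, mul_ite, mul_zero, mul_comm _ C]
    _ ≤ _ := by gcongr

end Regret

lemma sum_range_ite_sum_lt_le {b : ℕ → ℝ} (hb0 : ∀ n, 0 ≤ b n) (hb1 : ∀ n, b n ≤ 1) {T : ℝ}
    (hT : 0 ≤ T) (N : ℕ) :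
    ∑ r ∈ Finset.range N, (if ∑ i ∈ Finset.range r, b i < T then b r else 0) ≤ T + 1 := by
  suffices h : ∑ r ∈ Finset.range N, (if ∑ i ∈ Finset.range r, b i < T then b r else 0) ≤
      min (∑ i ∈ Finset.range N, b i) (T + 1) from h.trans (min_le_right _ _)
  induction N with
  | zero => simpa using hT.trans (lt_add_one T).le
  | succ N ih =>
    rw [le_min_iff] at ih ⊢
    rw [Finset.sum_range_succ, Finset.sum_range_succ b]
    split_ifs with hlt
    · exact ⟨by linarith, by linarith [hb1 N]⟩
    · exact ⟨by linarith [hb0 N], by linarith⟩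

lemma isLittleO_sq_of_forall_le {f : ℕ → ℝ} (hf0 : ∀ N, 0 ≤ f N)
    (hf : ∀ δ > 0, ∃ K, ∀ N : ℕ, f N ≤ δ * (N : ℝ) ^ 2 + K * N) :
    f =o[atTop] fun N : ℕ => (N : ℝ) ^ 2 := by
  refine Asymptotics.isLittleO_iff.2 fun c hc => ?_
  obtain ⟨K, hK⟩ := hf (c / 2) (half_pos hc)
  filter_upwards [tendsto_natCast_atTop_atTop.eventually_ge_atTop (2 * K / c)] with N hN
  rw [Real.norm_of_nonneg (hf0 N), Real.norm_of_nonneg (sq_nonneg _)]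
  have hlin : 2 * K * N ≤ c * N * N :=
    mul_le_mul_of_nonneg_right ((div_le_iff₀' hc).1 hN) N.cast_nonneg
  linarith [hK N]

section Convergence

variable {E ι X : Type*} [NormedAddCommGroup E] [NormedSpace ℝ E] [Fintype ι] [Fintype X]
  {U : X → Set E} {φ : X → E → ι → ℝ} {D : X → (ι → ℝ) → ℝ} {p q : ℕ → ι → ℝ} {μ w : ℕ → X → ℝ}

/-- The payoff of `D x` against the sum of the first `n` answers of the first player. -/
def cumulatedPayoff (D : X → (ι → ℝ) → ℝ) (q : ℕ → ι → ℝ) (x : X) (n : ℕ) : ℝ :=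
  D x (∑ i ∈ Finset.range n, q i)

namespace IsPlay

lemma answer_mem_stdSimplex {F : (ι → ℝ) → (X → ℝ) → ℝ} (hplay : IsPlay F p q μ w) (n : ℕ) :
    q n ∈ stdSimplex ℝ ι :=
  mem_stdSimplex_of_mem_lmoP (hplay.answer_p_mem n)

lemma sum_answer_nonneg {F : (ι → ℝ) → (X → ℝ) → ℝ} (hplay : IsPlay F p q μ w)
    (s : Finset ℕ) (f : ℕ → ℕ) : 0 ≤ ∑ i ∈ s, q (f i) :=
  Finset.sum_nonneg fun i _ => (hplay.answer_mem_stdSimplex (f i)).1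

lemma sum_sum_answer {F : (ι → ℝ) → (X → ℝ) → ℝ} (hplay : IsPlay F p q μ w) (r l : ℕ) :
    ∑ j, (∑ i ∈ Finset.range l, q (r + i)) j = l := by
  simp only [Finset.sum_apply]
  rw [Finset.sum_comm]
  simp [(hplay.answer_mem_stdSimplex _).2]

lemma sum_answer_mul {F : (ι → ℝ) → (X → ℝ) → ℝ} (hplay : IsPlay F p q μ w) (s : ℕ)
    (g : X → ℝ) :
    ∑ x, (∑ i ∈ Finset.range s, w i x) * g x = s * ∑ x, μ s x * g x := by
  simp only [← Finset.sum_apply, ← hplay.smul_mu, Pi.smul_apply, smul_eq_mul, Finset.mul_sum,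
    mul_assoc]

lemma cumulatedPayoff_eq (hplay : IsPlay (mixedPayoff D) p q μ w)
    (h : ∀ x, IsScenario (U x) (φ x) (D x)) (x : X) (n : ℕ) :
    cumulatedPayoff D q x n = n * D x (p n) := by
  rw [cumulatedPayoff, ← hplay.smul_p, (h x).map_smul (hplay.p_mem n).1 n.cast_nonneg]

lemma sum_answer_mul_sub (hplay : IsPlay (mixedPayoff D) p q μ w) (s l : ℕ) :
    ∑ x, (∑ i ∈ Finset.range s, w i x) *
      (cumulatedPayoff D q x (s + l) - cumulatedPayoff D q x s) =
      s * (mixedPayoff D (∑ i ∈ Finset.range s, q i + ∑ i ∈ Finset.range l, q (s + i)) (μ s) -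
        mixedPayoff D (∑ i ∈ Finset.range s, q i) (μ s)) := by
  rw [hplay.sum_answer_mul]
  simp only [cumulatedPayoff, mixedPayoff, mul_sub, Finset.sum_sub_distrib, Finset.sum_range_add]

lemma clarkeGrad_subset (hplay : IsPlay (mixedPayoff D) p q μ w)
    (h : ∀ x, IsScenario (U x) (φ x) (D x)) {C : ℝ} (hC : ∀ x, ∀ u ∈ U x, ∀ i, φ x u i ≤ C)
    (n : ℕ) :
    clarkeGrad (mixedPayoff D) (p n) (μ n) ⊆
      boundedSupergradient (fun p => mixedPayoff D p (μ n)) C (∑ i ∈ Finset.range n, q i) := by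
  rw [← hplay.smul_p]
  exact (clarkeGrad_subset_boundedSupergradient h hC (hplay.p_mem n).1).trans
    (boundedSupergradient_subset_smul (mixedPayoff_smul h _ (hplay.p_mem n).1 n.cast_nonneg))

lemma clarkeGrad_nonempty {F : (ι → ℝ) → (X → ℝ) → ℝ} (hplay : IsPlay F p q μ w) (n : ℕ) :
    (clarkeGrad F (p n) (μ n)).Nonempty :=
  clarkeGrad_nonempty_of_mem_lmoP (hplay.answer_p_mem n)

lemma sum_answer_mul_sub_le (hplay : IsPlay (mixedPayoff D) p q μ w)
    (h : ∀ x, IsScenario (U x) (φ x) (D x)) (s l : ℕ) :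
    ∑ x, (∑ i ∈ Finset.range s, w i x) *
      (cumulatedPayoff D q x (s + l) - cumulatedPayoff D q x s) ≤
      l * (s * bestSlope (mixedPayoff D) (p s) (μ s)) := by
  obtain ⟨C, hC⟩ := (eventually_all.2 fun x => (h x).eventually_cost_le).exists
  have hle := sub_le_mul_bestSlope (hplay.clarkeGrad_subset h hC s) (hplay.clarkeGrad_nonempty s)
    (hplay.sum_answer_nonneg (Finset.range s) id)
    (hplay.sum_answer_nonneg (Finset.range l) (s + ·))
  rw [hplay.sum_sum_answer] at hle
  rw [hplay.sum_answer_mul_sub, mul_left_comm]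
  exact mul_le_mul_of_nonneg_left hle s.cast_nonneg

end IsPlay

/-- The regret of the first player along a run of self-play. -/
def playRegret (D : X → (ι → ℝ) → ℝ) (p q : ℕ → ι → ℝ) (μ w : ℕ → X → ℝ) : ℕ → ℝ :=
  regret (cumulatedPayoff D q) (fun x r => w r x)
    fun r => r * bestSlope (mixedPayoff D) (p r) (μ r)

namespace IsPlay

lemma playRegret_nonneg (hplay : IsPlay (mixedPayoff D) p q μ w)
    (h : ∀ x, IsScenario (U x) (φ x) (D x)) (r : ℕ) : 0 ≤ playRegret D p q μ w r := by
  simpa [playRegret, regret] using hplay.sum_answer_mul_sub_le h r 1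

lemma eventually_playRegret_le (hplay : IsPlay (mixedPayoff D) p q μ w)
    (h : ∀ x, IsScenario (U x) (φ x) (D x)) {C : ℝ} (hC : ∀ x, ∀ u ∈ U x, ∀ i, φ x u i ≤ C)
    {δ : ℝ} (hδ : 0 < δ) :
    ∀ᶠ L : ℝ in atTop, ∀ r : ℕ, playRegret D p q μ w r ≤
      r * (δ + C * ∑ i, if ∑ j ∈ Finset.range r, q j i < L then q r i else 0) := by
  filter_upwards [eventually_bestSlope_le h hδ C] with L hL r
  have hslope := hL (p r) (q r) (∑ i ∈ Finset.range r, q i) (μ r)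
    (hplay.sum_answer_nonneg (Finset.range r) id) (hplay.mu_mem r) (hplay.clarkeGrad_subset h hC r)
    (hplay.answer_p_mem r)
  rw [playRegret, regret, hplay.sum_answer_mul_sub, ← mul_sub]
  simp only [Finset.sum_apply, Finset.sum_range_one, add_zero] at hslope ⊢
  exact mul_le_mul_of_nonneg_left (by linarith) r.cast_nonneg

lemma exists_sum_playRegret_le (hplay : IsPlay (mixedPayoff D) p q μ w)
    (h : ∀ x, IsScenario (U x) (φ x) (D x)) {δ : ℝ} (hδ : 0 < δ) :
    ∃ K, ∀ N : ℕ, ∑ r ∈ Finset.range N, playRegret D p q μ w r ≤ δ * (N : ℝ) ^ 2 + K * N := by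
  obtain ⟨C, hC, hC0⟩ := ((eventually_all.2 fun x => (h x).eventually_cost_le).and
    (eventually_ge_atTop 0)).exists
  obtain ⟨L, hL, hL0⟩ :=
    ((hplay.eventually_playRegret_le h hC hδ).and (eventually_ge_atTop 0)).exists
  set b : ℕ → ι → ℝ := fun r i => if ∑ j ∈ Finset.range r, q j i < L then q r i else 0
  have hb0 : ∀ r i, 0 ≤ b r i := fun r i => by
    simp only [b]
    split_ifs
    exacts [(hplay.answer_mem_stdSimplex r).1 i, le_rfl]
  refine ⟨C * ∑ _ : ι, (L + 1), fun N => ?_⟩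
  calc ∑ r ∈ Finset.range N, playRegret D p q μ w r
      ≤ ∑ r ∈ Finset.range N, (N : ℝ) * (δ + C * ∑ i, b r i) := by
        refine Finset.sum_le_sum fun r hr => (hL r).trans ?_
        have hrN : (r : ℝ) ≤ N := Nat.cast_le.2 (Finset.mem_range.1 hr).le
        exact mul_le_mul_of_nonneg_right hrN
          (add_nonneg hδ.le (mul_nonneg hC0 (Finset.sum_nonneg fun i _ => hb0 r i)))
    _ = δ * (N : ℝ) ^ 2 + C * (∑ i, ∑ r ∈ Finset.range N, b r i) * N := by
        rw [← Finset.mul_sum, Finset.sum_add_distrib, ← Finset.mul_sum, Finset.sum_comm]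
        simp only [Finset.sum_const, Finset.card_range, nsmul_eq_mul]
        ring
    _ ≤ δ * (N : ℝ) ^ 2 + C * (∑ _ : ι, (L + 1)) * N := by
        gcongr with i
        exact sum_range_ite_sum_lt_le (fun n => (hplay.answer_mem_stdSimplex n).1 i)
          (fun n => (mem_Icc_of_mem_stdSimplex (hplay.answer_mem_stdSimplex n) i).2) hL0 N

lemma isLittleO_sum_playRegret (hplay : IsPlay (mixedPayoff D) p q μ w)
    (h : ∀ x, IsScenario (U x) (φ x) (D x)) :
    (fun N => ∑ r ∈ Finset.range N, playRegret D p q μ w r) =o[atTop]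
      fun N : ℕ => (N : ℝ) ^ 2 :=
  isLittleO_sq_of_forall_le
    (fun _ => Finset.sum_nonneg fun r _ => hplay.playRegret_nonneg h r)
    fun _ hδ => hplay.exists_sum_playRegret_le h hδ

lemma weight_mul_cumulatedPayoff_sub_eq_zero [Nonempty X]
    (hplay : IsPlay (mixedPayoff D) p q μ w) (h : ∀ x, IsScenario (U x) (φ x) (D x)) (x : X)
    (r : ℕ) : w r x * (cumulatedPayoff D q x r - r * ⨅ y, D y (p r)) = 0 := by
  obtain ⟨x₀, hx₀⟩ := exists_eq_ciInf_of_finite (f := fun y => D y (p r))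
  have hzero := weight_mul_gradMu_sub_eq_zero (hplay.answer_mu_mem r) (x₀ := x₀) (fun y => by
    simpa only [gradMu_mixedPayoff, hx₀] using ciInf_le (Set.finite_range _).bddBelow y) x
  simp only [gradMu_mixedPayoff, hx₀] at hzero
  rw [hplay.cumulatedPayoff_eq h, ← mul_sub, mul_left_comm, hzero, mul_zero]

lemma isSelfPlay [Nonempty X] (hplay : IsPlay (mixedPayoff D) p q μ w)
    (h : ∀ x, IsScenario (U x) (φ x) (D x)) {C : ℝ} (hC : ∀ x, ∀ u ∈ U x, ∀ i, φ x u i ≤ C)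
    {p₀ : ι → ℝ} {μ₀ : X → ℝ} (hN : IsNash (mixedPayoff D) p₀ μ₀) :
    IsSelfPlay (cumulatedPayoff D q) (fun x r => w r x) (fun r => r * ⨅ x, D x (p r))
      (fun r => r * bestSlope (mixedPayoff D) (p r) (μ r)) C (mixedPayoff D p₀ μ₀) where
  weight_nonneg x r := (hplay.answer_mu_mem r).1.1 x
  sum_weight r := (hplay.answer_mu_mem r).1.2
  payoff_nonneg x r := (h x).nonneg (hplay.sum_answer_nonneg (Finset.range r) id)
  payoff_mono x := monotone_nat_of_le_succ fun n => by
    rw [cumulatedPayoff, cumulatedPayoff, Finset.sum_range_succ]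
    exact (h x).map_le_map_add (hplay.sum_answer_nonneg (Finset.range n) id)
      (hplay.answer_mem_stdSimplex n).1
  payoff_add_le x r l := by
    rw [cumulatedPayoff, cumulatedPayoff, Finset.sum_range_add, ← hplay.sum_sum_answer r l]
    exact (h x).map_add_le (hC x) (hplay.sum_answer_nonneg (Finset.range r) id)
      (hplay.sum_answer_nonneg (Finset.range l) (r + ·))
  value_le x r := by
    rw [hplay.cumulatedPayoff_eq h]
    exact mul_le_mul_of_nonneg_left (ciInf_le (Set.finite_range _).bddBelow x) r.cast_nonneg
  weight_mul_gap := hplay.weight_mul_cumulatedPayoff_sub_eq_zero h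
  sum_increment_le := hplay.sum_answer_mul_sub_le h
  slope_le r := by
    obtain ⟨f, hf⟩ := hplay.clarkeGrad_nonempty r
    have hsub := hplay.clarkeGrad_subset h hC r
    rw [mul_comm C]
    exact mul_le_mul_of_nonneg_left
      (bestSlope_le_of_mem hsub (hplay.p_mem r) hf (hsub hf).2.2) r.cast_nonneg
  le_slope r := mul_le_mul_of_nonneg_left ((hN.2.2.2 (μ r) (hplay.mu_mem r)).trans
    (le_bestSlope (hplay.clarkeGrad_subset h hC r) (hplay.clarkeGrad_nonempty r) hN.1))
    r.cast_nonneg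
  value_le_mul r := by
    refine mul_le_mul_of_nonneg_left (le_trans ?_ (hN.2.2.1 (p r) (hplay.p_mem r))) r.cast_nonneg
    rw [← one_mul (⨅ x, D x (p r)), ← hN.2.1.2, Finset.sum_mul]
    exact Finset.sum_le_sum fun x _ =>
      mul_le_mul_of_nonneg_left (ciInf_le (Set.finite_range _).bddBelow x) (hN.2.1.1 x)
  sum_regret := hplay.isLittleO_sum_playRegret h

lemma tendsto_mixedPayoff [Nonempty X] (hplay : IsPlay (mixedPayoff D) p q μ w)
    (h : ∀ x, IsScenario (U x) (φ x) (D x)) {p₀ : ι → ℝ} {μ₀ : X → ℝ}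
    (hN : IsNash (mixedPayoff D) p₀ μ₀) :
    Tendsto (fun n => mixedPayoff D (p n) (μ n)) atTop (𝓝 (mixedPayoff D p₀ μ₀)) := by
  obtain ⟨C, hC⟩ := (eventually_all.2 fun x => (h x).eventually_cost_le).exists
  refine (hplay.isSelfPlay h hC hN).tendsto_payoff.congr' ?_
  filter_upwards [eventually_ne_atTop 0] with n hn
  have hn' : (n : ℝ) ≠ 0 := Nat.cast_ne_zero.2 hn
  have hsum : ∑ x, μ n x * cumulatedPayoff D q x n = n * mixedPayoff D (p n) (μ n) := by
    simp only [hplay.cumulatedPayoff_eq h, mixedPayoff, Finset.mul_sum, mul_left_comm]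
  rw [hplay.sum_answer_mul, hsum, ← mul_assoc, ← sq, mul_div_cancel_left₀ _ (pow_ne_zero 2 hn')]

end IsPlay

lemma exists_isNash [Nonempty X] [Nonempty ι] (h : ∀ x, IsScenario (U x) (φ x) (D x)) :
    ∃ p μ, IsNash (mixedPayoff D) p μ := by
  classical
  have hsub : stdSimplex ℝ ι ⊆ Set.Ici 0 := fun _ hp => hp.1
  have hlin : ∀ p, IsLinearMap ℝ (mixedPayoff D p) := fun p =>
    ⟨fun μ μ' => by simp [mixedPayoff, add_mul, Finset.sum_add_distrib],
      fun c μ => by simp [mixedPayoff, Finset.mul_sum, mul_assoc]⟩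
  have hcont : ∀ p, Continuous (mixedPayoff D p) := fun p => by
    unfold mixedPayoff
    fun_prop
  obtain ⟨μ, hμ, p, hp, hsaddle⟩ := Sion.exists_isSaddlePointOn (X := stdSimplex ℝ X)
    (Y := stdSimplex ℝ ι) (f := fun μ p => mixedPayoff D p μ)
    ⟨_, single_mem_stdSimplex ℝ (Classical.arbitrary X)⟩ (convex_stdSimplex ℝ X)
    (isCompact_stdSimplex ℝ X)
    (fun p _ => (hcont p).continuousOn.lowerSemicontinuousOn)
    (fun p _ => (((hlin p).mk' _).convexOn (convex_stdSimplex ℝ X)).quasiconvexOn)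
    (convex_stdSimplex ℝ ι) ⟨_, single_mem_stdSimplex ℝ (Classical.arbitrary ι)⟩
    (isCompact_stdSimplex ℝ ι)
    (fun μ _ => ((continuousOn_mixedPayoff h μ).mono hsub).upperSemicontinuousOn)
    (fun μ hμ => ((concaveOn_mixedPayoff h hμ.1).subset hsub
      (convex_stdSimplex ℝ ι)).quasiconcaveOn)
  exact ⟨p, μ, hp, hμ, fun p' hp' => hsaddle μ hμ p' hp', fun μ' hμ' => hsaddle μ' hμ' p hp⟩

lemma IsNash.payoff_le {F : (ι → ℝ) → (X → ℝ) → ℝ} {p p' : ι → ℝ} {μ μ' : X → ℝ}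
    (h : IsNash F p μ) (h' : IsNash F p' μ') : F p μ ≤ F p' μ' :=
  (h.2.2.2 μ' h'.2.1).trans (h'.2.2.1 p h.1)

theorem exists_isGameValue_and_tendsto [Nonempty X] [Nonempty ι]
    (h : ∀ x, IsScenario (U x) (φ x) (D x)) :
    ∃ v, IsGameValue (mixedPayoff D) v ∧ ∀ p μ, IsTrajectory (mixedPayoff D) p μ →
      Tendsto (fun n => mixedPayoff D (p n) (μ n)) atTop (𝓝 v) := by
  obtain ⟨p₀, μ₀, hN⟩ := exists_isNash h
  refine ⟨mixedPayoff D p₀ μ₀, ⟨⟨p₀, μ₀, hN⟩, fun p μ hN' =>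
    (hN'.payoff_le hN).antisymm (hN.payoff_le hN')⟩, fun p μ htraj => ?_⟩
  obtain ⟨q, w, hplay⟩ := exists_isPlay htraj
  exact hplay.tendsto_mixedPayoff h hN

end Convergence

section Infima

lemma sInf_image_eq_sInf_image {α β : Type*} {f : α → ℝ} {g : β → ℝ} {A : Set α} {B : Set β}
    (hB : B.Nonempty) (hg : ∀ b ∈ B, 0 ≤ g b) (hBA : ∀ a ∈ A, ∃ b ∈ B, g b ≤ f a)
    (hAB : ∀ b ∈ B, ∀ ε > 0, ∃ a ∈ A, f a < g b + ε) : sInf (f '' A) = sInf (g '' B) := by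
  obtain ⟨b₀, hb₀⟩ := hB
  obtain ⟨a₀, ha₀, -⟩ := hAB b₀ hb₀ 1 one_pos
  have hgB : BddBelow (g '' B) := ⟨0, Set.forall_mem_image.2 hg⟩
  have hfA : BddBelow (f '' A) := ⟨0, Set.forall_mem_image.2 fun a ha =>
    let ⟨b, hb, hba⟩ := hBA a ha
    (hg b hb).trans hba⟩
  refine le_antisymm (le_csInf ⟨_, b₀, hb₀, rfl⟩ (Set.forall_mem_image.2 fun b hb =>
    le_of_forall_pos_le_add fun ε hε => ?_))
    (le_csInf ⟨_, a₀, ha₀, rfl⟩ (Set.forall_mem_image.2 fun a ha => ?_))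
  · obtain ⟨a, ha, hab⟩ := hAB b hb ε hε
    exact (csInf_le hfA (Set.mem_image_of_mem f ha)).trans hab.le
  · obtain ⟨b, hb, hba⟩ := hBA a ha
    exact (csInf_le hgB (Set.mem_image_of_mem g hb)).trans hba

end Infima

section Tilting

open InformationTheory

variable {α : Type*} [MeasurableSpace α] {μ : Measure α} [IsProbabilityMeasure μ] {f : α → ℝ}

lemma klDiv_tilted_ne_top (hf : Integrable f μ) (hexp : Integrable (fun y => Real.exp (f y)) μ) :
    klDiv μ (μ.tilted f) ≠ ∞ :=
  klDiv_ne_top (absolutelyContinuous_tilted hexp) <| integrable_llr_tilted_right .rfl hf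
    ((integrable_congr (llr_self μ)).2 (integrable_zero _ _ _)) hexp

lemma toReal_klDiv_tilted (hf : Integrable f μ)
    (hexp : Integrable (fun y => Real.exp (f y)) μ) :
    (klDiv μ (μ.tilted f)).toReal = Real.log (∫ y, Real.exp (f y) ∂μ) - ∫ y, f y ∂μ := by
  have := isProbabilityMeasure_tilted hexp
  have hself : Integrable (llr μ μ) μ := (integrable_congr (llr_self μ)).2 (integrable_zero _ _ _)
  rw [toReal_klDiv_of_measure_eq (absolutelyContinuous_tilted hexp) (by simp only [measure_univ]),
    integral_llr_tilted_right .rfl hf hexp hself, integral_congr_ae (llr_self μ)]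
  simp only [Pi.zero_apply, integral_zero, zero_sub, neg_add_eq_sub]

lemma ae_eq_const_of_tilted_eq_self (hexp : Integrable (fun y => Real.exp (f y)) μ)
    (h : μ.tilted f = μ) : ∀ᵐ y ∂μ, f y = Real.log (∫ y, Real.exp (f y) ∂μ) := by
  filter_upwards [log_rnDeriv_tilted_left_self hexp, μ.rnDeriv_self] with y hlog hone
  rw [h, hone, ENNReal.toReal_one, Real.log_one] at hlog
  linarith

end Tilting

section ExponentialFamily

open InformationTheory

variable {ν : Measure ℝ} {a b c d : ℝ}

lemma integrable_exp_of_mem_natSpace (ha : a ∈ natSpace ν) :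
    Integrable (fun y => Real.exp (a * y)) ν :=
  integrable_of_mem_integrableExpSet (X := id) (interior_subset ha)

lemma convex_natSpace (ν : Measure ℝ) : Convex ℝ (natSpace ν) := convex_integrableExpSet.interior

lemma isProbabilityMeasure_natDist [NeZero ν] (ha : a ∈ natSpace ν) :
    IsProbabilityMeasure (natDist ν a) :=
  isProbabilityMeasure_tilted (integrable_exp_of_mem_natSpace ha)

lemma integrable_id_natDist (ha : a ∈ natSpace ν) : Integrable (fun y : ℝ => y) (natDist ν a) :=
  memLp_one_iff_integrable.1 (memLp_tilted_mul (X := id) ha 1)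

lemma natDist_eq_tilted (ha : a ∈ natSpace ν) (b : ℝ) :
    natDist ν b = (natDist ν a).tilted fun y => (b - a) * y := by
  have hsum : (fun y : ℝ => b * y) = (fun y => a * y) + fun y => (b - a) * y := by
    ext y
    simp only [Pi.add_apply]
    ring
  rw [natDist, natDist, tilted_tilted (integrable_exp_of_mem_natSpace ha), hsum]

lemma integrable_exp_natDist (ha : a ∈ natSpace ν) (hb : b ∈ natSpace ν) :
    Integrable (fun y => Real.exp ((b - a) * y)) (natDist ν a) := by
  rw [natDist, integrable_tilted_iff (integrable_exp_of_mem_natSpace ha)]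
  refine (integrable_exp_of_mem_natSpace hb).congr (Eventually.of_forall fun y => ?_)
  simp only [smul_eq_mul, ← Real.exp_add]
  congr 1
  ring

lemma integral_exp_natDist (ν : Measure ℝ) (a b : ℝ) :
    ∫ y, Real.exp ((b - a) * y) ∂natDist ν a = mgf id ν b / mgf id ν a := by
  rw [natDist, integral_exp_tilted]
  simp only [mgf, id_eq, Pi.add_apply, ← add_mul, add_sub_cancel]

/-- The divergence between two members of the family, as a function of natural parameters. -/
def natKL (ν : Measure ℝ) (a b : ℝ) : ℝ := (klDiv (natDist ν a) (natDist ν b)).toReal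

lemma natKL_nonneg (ν : Measure ℝ) (a b : ℝ) : 0 ≤ natKL ν a b := ENNReal.toReal_nonneg

section NeZero

variable [NeZero ν]

lemma natKL_eq (ha : a ∈ natSpace ν) (hb : b ∈ natSpace ν) :
    natKL ν a b = cgf id ν b - cgf id ν a - (b - a) * natMean ν a := by
  have := isProbabilityMeasure_natDist ha
  have hmgf : ∀ {c}, c ∈ natSpace ν → mgf id ν c ≠ 0 := fun hc =>
    (mgf_pos' (NeZero.ne ν) (integrable_exp_of_mem_natSpace hc)).ne'
  rw [natKL, natDist_eq_tilted ha b,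
    toReal_klDiv_tilted ((integrable_id_natDist ha).const_mul _) (integrable_exp_natDist ha hb),
    integral_exp_natDist, Real.log_div (hmgf hb) (hmgf ha), integral_const_mul, cgf, cgf, natMean]

lemma natKL_self (ha : a ∈ natSpace ν) : natKL ν a a = 0 := by
  rw [natKL_eq ha ha]; ring

lemma natDist_eq_of_natKL_eq_zero (ha : a ∈ natSpace ν) (hb : b ∈ natSpace ν)
    (h : natKL ν a b = 0) : natDist ν a = natDist ν b := by
  have := isProbabilityMeasure_natDist ha
  have := isProbabilityMeasure_natDist hb
  have hne : klDiv (natDist ν a) (natDist ν b) ≠ ∞ := by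
    rw [natDist_eq_tilted ha b]
    exact klDiv_tilted_ne_top ((integrable_id_natDist ha).const_mul _)
      (integrable_exp_natDist ha hb)
  exact klDiv_eq_zero_iff.1 (((ENNReal.toReal_eq_zero_iff _).1 h).resolve_right hne)

lemma continuousOn_natKL (ha : a ∈ natSpace ν) : ContinuousOn (natKL ν a) (natSpace ν) :=
  (((analyticOnNhd_cgf (X := id) (μ := ν)).continuousOn.sub continuousOn_const).sub
    (by fun_prop)).congr fun _ hb => natKL_eq ha hb

lemma natKL_eq_add (ha : a ∈ natSpace ν) (hb : b ∈ natSpace ν) (hc : c ∈ natSpace ν) :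
    natKL ν a c = natKL ν a b + natKL ν b c + (c - b) * (natMean ν b - natMean ν a) := by
  rw [natKL_eq ha hc, natKL_eq ha hb, natKL_eq hb hc]; ring

lemma sub_mul_natMean_sub (ha : a ∈ natSpace ν) (hb : b ∈ natSpace ν) :
    (b - a) * (natMean ν b - natMean ν a) = natKL ν a b + natKL ν b a := by
  rw [natKL_eq ha hb, natKL_eq hb ha]; ring

lemma monotoneOn_natMean (ν : Measure ℝ) [NeZero ν] : MonotoneOn (natMean ν) (natSpace ν) := by
  intro a ha b hb hab
  rcases hab.eq_or_lt with rfl | hlt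
  · exact le_rfl
  · have hpos : 0 ≤ (b - a) * (natMean ν b - natMean ν a) :=
      (sub_mul_natMean_sub ha hb).symm ▸ add_nonneg (natKL_nonneg _ _ _) (natKL_nonneg _ _ _)
    exact sub_nonneg.1 (nonneg_of_mul_nonneg_right hpos (sub_pos.2 hlt))

lemma natMean_eq_of_natDist_eq (ha : a ∈ natSpace ν) (hb : b ∈ natSpace ν) (hab : a ≠ b)
    (h : natDist ν a = natDist ν b) (hc : c ∈ natSpace ν) :
    natMean ν c = Real.log (∫ y, Real.exp ((b - a) * y) ∂natDist ν a) / (b - a) := by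
  have := isProbabilityMeasure_natDist ha
  have := isProbabilityMeasure_natDist hc
  have hconst : ∀ᵐ y ∂natDist ν a,
      y = Real.log (∫ y, Real.exp ((b - a) * y) ∂natDist ν a) / (b - a) := by
    filter_upwards [ae_eq_const_of_tilted_eq_self (integrable_exp_natDist ha hb)
      ((natDist_eq_tilted ha b).symm.trans h.symm)] with y hy
    rw [eq_div_iff (sub_ne_zero.2 hab.symm), mul_comm, hy]
  have hac : natDist ν c ≪ natDist ν a := by
    rw [natDist_eq_tilted ha c]
    exact tilted_absolutelyContinuous _ _
  rw [natMean, integral_congr_ae (hac.ae_le hconst), integral_const, probReal_univ, one_smul]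

lemma strictMonoOn_natMean (hν : (meanSpace ν).Nontrivial) :
    StrictMonoOn (natMean ν) (natSpace ν) := by
  intro a ha b hb hab
  refine (monotoneOn_natMean ν ha hb hab.le).lt_of_ne fun heq => ?_
  have hsum := sub_mul_natMean_sub ha hb
  rw [heq, sub_self, mul_zero] at hsum
  have hzero : natKL ν a b = 0 := by linarith [natKL_nonneg ν a b, natKL_nonneg ν b a]
  have hmean : ∀ c ∈ natSpace ν, _ := fun c hc =>
    natMean_eq_of_natDist_eq ha hb hab.ne (natDist_eq_of_natKL_eq_zero ha hb hzero) hc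
  obtain ⟨_, ⟨c, hc, rfl⟩, _, ⟨c', hc', rfl⟩, hne⟩ := hν
  exact hne ((hmean c hc).trans (hmean c' hc').symm)

lemma antitoneOn_natKL (ha : a ∈ natSpace ν) :
    AntitoneOn (natKL ν a) (natSpace ν ∩ Set.Iic a) := by
  intro c hc b hb hcb
  rw [natKL_eq_add ha hb.1 hc.1]
  nlinarith [natKL_nonneg ν b c, monotoneOn_natMean ν hb.1 ha hb.2]

lemma monotoneOn_natKL (ha : a ∈ natSpace ν) :
    MonotoneOn (natKL ν a) (natSpace ν ∩ Set.Ici a) := by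
  intro b hb c hc hbc
  rw [natKL_eq_add ha hb.1 hc.1]
  nlinarith [natKL_nonneg ν b c, monotoneOn_natMean ν ha hb.1 hb.2]

lemma exists_mem_Icc_natKL_le (ha : a ∈ natSpace ν) (hb : b ∈ natSpace ν) (hc : c ∈ natSpace ν)
    (hd : d ∈ natSpace ν) (hab : a ≤ b) (hcd : c ≤ d) :
    ∃ u ∈ Set.Icc a b, natKL ν b u ≤ natKL ν b c ∧ natKL ν a u ≤ natKL ν a d := by
  rcases le_total c a with hca | hac
  · exact ⟨a, Set.left_mem_Icc.2 hab, antitoneOn_natKL hb ⟨hc, hca.trans hab⟩ ⟨ha, hab⟩ hca,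
      (natKL_self ha).le.trans (natKL_nonneg ν a d)⟩
  rcases le_total c b with hcb | hbc
  · exact ⟨c, ⟨hac, hcb⟩, le_rfl, monotoneOn_natKL ha ⟨hc, hac⟩ ⟨hd, hac.trans hcd⟩ hcd⟩
  · exact ⟨b, Set.right_mem_Icc.2 hab, (natKL_self hb).le.trans (natKL_nonneg ν b c),
      monotoneOn_natKL ha ⟨hb, hab⟩ ⟨hd, hac.trans hcd⟩ (hbc.trans hcd)⟩

lemma mul_natKL_add_mul_natKL (ha : a ∈ natSpace ν) (hb : b ∈ natSpace ν) (hc : c ∈ natSpace ν)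
    {s t : ℝ} (hs : 0 ≤ s) (ht : 0 ≤ t) (hst : s + t = 1) :
    s * natKL ν a b + t * natKL ν a c = natKL ν a (s • b + t • c) +
      (s * natKL ν (s • b + t • c) b + t * natKL ν (s • b + t • c) c) := by
  have hmem := convex_natSpace ν hb hc hs ht hst
  rw [natKL_eq_add ha hmem hb, natKL_eq_add ha hmem hc]
  obtain rfl := eq_sub_of_add_eq' hst
  simp only [smul_eq_mul]
  ring

lemma convexOn_natKL (ha : a ∈ natSpace ν) : ConvexOn ℝ (natSpace ν) (natKL ν a) := by
  refine ⟨convex_natSpace ν, fun b hb c hc s t hs ht hst => ?_⟩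
  have hrest := add_nonneg (mul_nonneg hs (natKL_nonneg ν (s • b + t • c) b))
    (mul_nonneg ht (natKL_nonneg ν (s • b + t • c) c))
  exact (le_add_of_nonneg_right hrest).trans_eq (mul_natKL_add_mul_natKL ha hb hc hs ht hst).symm

lemma natKL_midpoint_lt (ha : a ∈ natSpace ν) (hb : b ∈ natSpace ν) (hc : c ∈ natSpace ν)
    (hne : natKL ν a b ≠ natKL ν a c) :
    natKL ν a ((1 / 2 : ℝ) • b + (1 / 2 : ℝ) • c) < (natKL ν a b + natKL ν a c) / 2 := by
  have hmem := convex_natSpace ν hb hc one_half_pos.le one_half_pos.le (add_halves 1)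
  have hsum := mul_natKL_add_mul_natKL ha hb hc one_half_pos.le one_half_pos.le (add_halves 1)
  set m := (1 / 2 : ℝ) • b + (1 / 2 : ℝ) • c
  by_contra! hle
  have hmb : natKL ν m b = 0 := by linarith [natKL_nonneg ν m b, natKL_nonneg ν m c]
  have hmc : natKL ν m c = 0 := by linarith [natKL_nonneg ν m b, natKL_nonneg ν m c]
  rw [natKL, natKL, ← natDist_eq_of_natKL_eq_zero hmem hb hmb,
    ← natDist_eq_of_natKL_eq_zero hmem hc hmc] at hne
  exact hne rfl

end NeZero

lemma neZero_of_nontrivial_meanSpace (hν : (meanSpace ν).Nontrivial) : NeZero ν := by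
  refine ⟨fun h0 => ?_⟩
  obtain ⟨_, ⟨a, -, rfl⟩, _, ⟨b, -, rfl⟩, hne⟩ := hν
  simp only [natMean, natDist, h0, tilted_zero_measure, integral_zero_measure, ne_eq,
    not_true_eq_false] at hne

end ExponentialFamily

section ExpModel

variable {ν : Measure ℝ} {K : ℕ}

/-- The natural parameter that represents the member with mean `m`. -/
def natParam (ν : Measure ℝ) (m : ℝ) : ℝ := Function.invFunOn (natMean ν) (natSpace ν) m

lemma natParam_mem {m : ℝ} (hm : m ∈ meanSpace ν) : natParam ν m ∈ natSpace ν :=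
  Function.invFunOn_mem hm

lemma natMean_natParam {m : ℝ} (hm : m ∈ meanSpace ν) : natMean ν (natParam ν m) = m :=
  Function.invFunOn_eq hm

lemma natParam_lt_natParam [NeZero ν] {m m' : ℝ} (hm : m ∈ meanSpace ν) (hm' : m' ∈ meanSpace ν)
    (hlt : m < m') : natParam ν m < natParam ν m' :=
  (monotoneOn_natMean ν).reflect_lt (natParam_mem hm) (natParam_mem hm')
    (by rwa [natMean_natParam hm, natMean_natParam hm'])

lemma armMean_expModel {ϑ : Fin K → ℝ} {i : Fin K} (h : ϑ i ∈ meanSpace ν) :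
    armMean (expModel ν K) ϑ i = ϑ i := natMean_natParam h

lemma information_expModel (θ ϑ p : Fin K → ℝ) : information (expModel ν K) θ p ϑ =
    ∑ i, p i * natKL ν (natParam ν (θ i)) (natParam ν (ϑ i)) := rfl

lemma information_expModel_natMean [NeZero ν] (hν : (meanSpace ν).Nontrivial)
    (θ p : Fin K → ℝ) {η : Fin K → ℝ} (hη : ∀ i, η i ∈ natSpace ν) :
    information (expModel ν K) θ p (fun i => natMean ν (η i)) =
      ∑ i, p i * natKL ν (natParam ν (θ i)) (η i) := by
  have hinv : ∀ i, natParam ν (natMean ν (η i)) = η i := fun i =>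
    (strictMonoOn_natMean hν).injOn.leftInvOn_invFunOn (hη i)
  simp only [information_expModel, hinv]

/-- The divergences from the true arms to those of a boundary point of the scenario `x`, at which
the arms `I` and `x` have the common natural parameter `u` and the other arms are unchanged. -/
def tieKL (ν : Measure ℝ) (θ : Fin K → ℝ) (I x : Fin K) (u : ℝ) (i : Fin K) : ℝ :=
  if i = I ∨ i = x then natKL ν (natParam ν (θ i)) u else 0

variable {θ : Fin K → ℝ} {I x : Fin K} {u : ℝ}

lemma tieKL_nonneg (ν : Measure ℝ) (θ : Fin K → ℝ) (I x : Fin K) (u : ℝ) :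
    0 ≤ tieKL ν θ I x u := fun i => by
  unfold tieKL
  split_ifs
  exacts [natKL_nonneg _ _ _, le_rfl]

section NeZero

variable [NeZero ν]

lemma continuousOn_tieKL (hθ : θ ∈ expParams ν K) (I x : Fin K) :
    ContinuousOn (tieKL ν θ I x) (natSpace ν) := continuousOn_pi.2 fun i => by
  by_cases hi : i = I ∨ i = x
  · simpa only [tieKL, if_pos hi] using continuousOn_natKL (natParam_mem (hθ i))
  · simpa only [tieKL, if_neg hi] using continuousOn_const

lemma convexOn_tieKL (hθ : θ ∈ expParams ν K) (I x : Fin K) :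
    ConvexOn ℝ (natSpace ν) (tieKL ν θ I x) := by
  refine ⟨convex_natSpace ν, fun u hu u' hu' s t hs ht hst i => ?_⟩
  by_cases hi : i = I ∨ i = x
  · simpa only [tieKL, if_pos hi, Pi.add_apply, Pi.smul_apply] using
      (convexOn_natKL (natParam_mem (hθ i))).2 hu hu' hs ht hst
  · simp only [tieKL, if_neg hi, Pi.add_apply, Pi.smul_apply, smul_zero, add_zero, le_refl]

lemma tieKL_midpoint_lt (hθ : θ ∈ expParams ν K) {u' : ℝ} (hu : u ∈ natSpace ν)
    (hu' : u' ∈ natSpace ν) {i : Fin K} (hne : tieKL ν θ I x u i ≠ tieKL ν θ I x u' i) :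
    tieKL ν θ I x ((1 / 2 : ℝ) • u + (1 / 2 : ℝ) • u') i <
      (tieKL ν θ I x u i + tieKL ν θ I x u' i) / 2 := by
  unfold tieKL at *
  split_ifs at * with hi
  · exact natKL_midpoint_lt (natParam_mem (hθ i)) hu hu' hne
  · exact absurd rfl hne

lemma exists_tieKL_le_information (hθ : θ ∈ expParams ν K) (hlt : θ x < θ I) {p : Fin K → ℝ}
    (hp : 0 ≤ p) {ϑ : Fin K → ℝ} (hϑ : ϑ ∈ altSet (expModel ν K) (expParams ν K) I x) :
    ∃ u ∈ Set.Icc (natParam ν (θ x)) (natParam ν (θ I)),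
      p ⬝ᵥ tieKL ν θ I x u ≤ information (expModel ν K) θ p ϑ := by
  obtain ⟨hϑS, hmean⟩ := hϑ
  rw [armMean_expModel (hϑS I), armMean_expModel (hϑS x)] at hmean
  obtain ⟨u, hu, hI, hx⟩ := exists_mem_Icc_natKL_le (natParam_mem (hθ x)) (natParam_mem (hθ I))
    (natParam_mem (hϑS I)) (natParam_mem (hϑS x)) (natParam_lt_natParam (hθ x) (hθ I) hlt).le
    (natParam_lt_natParam (hϑS I) (hϑS x) hmean).le
  refine ⟨u, hu, Finset.sum_le_sum fun i _ => mul_le_mul_of_nonneg_left ?_ (hp i)⟩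
  unfold tieKL
  split_ifs with hi
  · rcases hi with rfl | rfl
    exacts [hI, hx]
  · exact natKL_nonneg _ _ _

lemma continuousAt_sum_mul_natKL (hθ : θ ∈ expParams ν K) (p : Fin K → ℝ) {η : Fin K → ℝ}
    (hη : ∀ i, η i ∈ natSpace ν) :
    ContinuousAt (fun η' : Fin K → ℝ => ∑ i, p i * natKL ν (natParam ν (θ i)) (η' i)) η :=
  tendsto_finsetSum _ fun i _ => (((continuousOn_natKL (natParam_mem (hθ i))).continuousAt
    (isOpen_interior.mem_nhds (hη i))).tendsto.comp (continuousAt_apply i η)).const_mul _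

/-- The witness moves arm `x` slightly above the tie. -/
lemma exists_information_lt_tieKL_add (hν : (meanSpace ν).Nontrivial) (hθ : θ ∈ expParams ν K)
    (hxI : x ≠ I) (p : Fin K → ℝ) (hu : u ∈ natSpace ν) {ε : ℝ} (hε : 0 < ε) :
    ∃ ϑ ∈ altSet (expModel ν K) (expParams ν K) I x,
      information (expModel ν K) θ p ϑ < p ⬝ᵥ tieKL ν θ I x u + ε := by
  set η : ℝ → Fin K → ℝ := fun t =>
    Function.update (Function.update (fun i => natParam ν (θ i)) I u) x t with hη
  have hηI : ∀ t, η t I = u := fun t => by simp [hη, Function.update_of_ne hxI.symm]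
  have hηx : ∀ t, η t x = t := fun t => by simp [hη]
  have hmem : ∀ {t}, t ∈ natSpace ν → ∀ i, η t i ∈ natSpace ν := by
    intro t ht i
    simp only [hη, Function.update_apply]
    split_ifs
    exacts [ht, hu, natParam_mem (hθ i)]
  have htie : ∀ i, natKL ν (natParam ν (θ i)) (η u i) = tieKL ν θ I x u i := by
    intro i
    by_cases hix : i = x <;> by_cases hiI : i = I <;>
      simp [hη, tieKL, Function.update_apply, hix, hiI, natKL_self (natParam_mem (hθ i))]
  have hopen : natSpace ν ∈ 𝓝 u := isOpen_interior.mem_nhds hu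
  have hcont : ContinuousAt (fun t => ∑ i, p i * natKL ν (natParam ν (θ i)) (η t i)) u :=
    (continuousAt_sum_mul_natKL hθ p (hmem hu)).comp
      (continuous_const.update x continuous_id).continuousAt
  have hsmall := hcont.tendsto.eventually_lt_const (lt_add_of_pos_right _ hε)
  obtain ⟨t, ⟨htε, htN⟩, htu : u < t⟩ := (((hsmall.and hopen).filter_mono
    nhdsWithin_le_nhds).and (self_mem_nhdsWithin (s := Set.Ioi u))).exists
  refine ⟨fun i => natMean ν (η t i), ⟨fun i => ⟨η t i, hmem htN i, rfl⟩, ?_⟩, ?_⟩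
  · rw [armMean_expModel ⟨η t I, hmem htN I, rfl⟩, armMean_expModel ⟨η t x, hmem htN x, rfl⟩,
      hηI, hηx]
    exact strictMonoOn_natMean hν hu htN htu
  · rw [information_expModel_natMean hν θ p (hmem htN), dotProduct]
    simpa only [htie] using htε

end NeZero

theorem isScenario_expModel (hθ : θ ∈ expParams ν K) (hlt : θ x < θ I) :
    IsScenario (Set.Icc (natParam ν (θ x)) (natParam ν (θ I))) (tieKL ν θ I x)
      (fun p => scenarioPayoff (expModel ν K) (expParams ν K) θ I p x) := by
  have hν : (meanSpace ν).Nontrivial := ⟨_, hθ x, _, hθ I, hlt.ne⟩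
  have := neZero_of_nontrivial_meanSpace hν
  have hxI : x ≠ I := fun h => hlt.ne (congrArg θ h)
  have hsub : Set.Icc (natParam ν (θ x)) (natParam ν (θ I)) ⊆ natSpace ν :=
    (convex_natSpace ν).ordConnected.out (natParam_mem (hθ x)) (natParam_mem (hθ I))
  have hne : (Set.Icc (natParam ν (θ x)) (natParam ν (θ I))).Nonempty :=
    Set.nonempty_Icc.2 (natParam_lt_natParam (hθ x) (hθ I) hlt).le
  exact
    { isCompact := isCompact_Icc
      nonempty := hne
      continuousOn_cost := (continuousOn_tieKL hθ I x).mono hsub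
      cost_nonneg := fun u _ => tieKL_nonneg ν θ I x u
      convexOn := (convexOn_tieKL hθ I x).subset hsub (convex_Icc _ _)
      midpoint_lt := fun u hu u' hu' _ => tieKL_midpoint_lt hθ (hsub hu) (hsub hu')
      eq_sInf := fun p hp => sInf_image_eq_sInf_image hne
        (fun u _ => dotProduct_nonneg_of_nonneg hp (tieKL_nonneg ν θ I x u))
        (fun ϑ hϑ => exists_tieKL_le_information hθ hlt hp hϑ)
        (fun u hu ε hε => exists_information_lt_tieKL_add hν hθ hxI p (hsub hu) hε) }

end ExpModel

section Domination

lemma exists_minimal_abs_le {ι : Type*} [Fintype ι] (Q : AffineSubspace ℝ (ι → ℝ)) {y : ι → ℝ}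
    (hy : y ∈ Q) :
    ∃ z ∈ Q, |z| ≤ |y| ∧ ∀ z' ∈ Q, |z'| ≤ |z| → z ⬝ᵥ z ≤ z' ⬝ᵥ z' := by
  have hmem : ∀ z : ι → ℝ, z ∈ Set.Icc (-|y|) |y| ↔ |z| ≤ |y| := fun z => by
    rw [Set.mem_Icc, neg_le, and_comm, ← abs_le']
  have hcompact : IsCompact ((Q : Set (ι → ℝ)) ∩ Set.Icc (-|y|) |y|) :=
    isCompact_Icc.inter_left Q.closed_of_finiteDimensional
  obtain ⟨z, ⟨hzQ, hzy⟩, hmin⟩ := hcompact.exists_isMinOn ⟨y, hy, (hmem y).2 le_rfl⟩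
    (by fun_prop : Continuous fun z : ι → ℝ => z ⬝ᵥ z).continuousOn
  exact ⟨z, hzQ, (hmem z).1 hzy,
    fun z' hz' hle => hmin ⟨hz', (hmem z').2 (hle.trans ((hmem z).1 hzy))⟩⟩

lemma exists_direction_tendsto_inv_norm_smul {E : Type*} [NormedAddCommGroup E]
    [NormedSpace ℝ E] [FiniteDimensional ℝ E] (Q : AffineSubspace ℝ E) {z : ℕ → E}
    (hz : ∀ n, z n ∈ Q) (hinf : Tendsto (fun n => ‖z n‖) atTop atTop) :
    ∃ w ∈ Q.direction, w ≠ 0 ∧ ∃ σ : ℕ → ℕ, StrictMono σ ∧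
      Tendsto (fun n => ‖z (σ n)‖⁻¹ • z (σ n)) atTop (𝓝 w) := by
  have : ProperSpace E := FiniteDimensional.proper ℝ E
  obtain ⟨w, -, σ, hσ, hlim⟩ := (isCompact_closedBall (0 : E) 1).tendsto_subseq
    (x := fun n => ‖z n‖⁻¹ • z n) fun n => by
      rw [mem_closedBall_zero_iff, norm_smul, norm_inv, norm_norm]
      exact inv_mul_le_one
  have hinfσ : Tendsto (fun n => ‖z (σ n)‖) atTop atTop := hinf.comp hσ.tendsto_atTop
  refine ⟨w, ?_, fun hw => ?_, σ, hσ, hlim⟩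
  · have hdiff : Tendsto (fun n => ‖z (σ n)‖⁻¹ • (z (σ n) - z 0)) atTop (𝓝 w) := by
      simpa only [Function.comp_apply, Pi.inv_apply, smul_sub, zero_smul, sub_zero] using
        hlim.sub (hinfσ.inv_tendsto_atTop.smul_const (z 0))
    exact Q.direction.closed_of_finiteDimensional.mem_of_tendsto hdiff <|
      Eventually.of_forall fun n =>
        Q.direction.smul_mem _ (AffineSubspace.vsub_mem_direction (hz _) (hz 0))
  · have hone : ∀ᶠ n in atTop, ‖‖z (σ n)‖⁻¹ • z (σ n)‖ = 1 := by
      filter_upwards [hinfσ.eventually_gt_atTop 0] with n hn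
      rw [norm_smul, norm_inv, norm_norm]
      exact inv_mul_cancel₀ hn.ne'
    have hnorm := tendsto_nhds_unique (hlim.norm.congr' hone) tendsto_const_nhds
    rw [hw, norm_zero] at hnorm
    exact zero_ne_one hnorm

lemma eventually_abs_sub_lt {α : Type*} {l : Filter α} {a r : α → ℝ} {w : ℝ} (hw : w ≠ 0)
    (hr : Tendsto r l atTop) (ha : Tendsto (fun n => (r n)⁻¹ * a n) l (𝓝 w)) :
    ∀ᶠ n in l, |a n - w| < |a n| := by
  have hww : 0 < w * w := mul_self_pos.2 hw
  filter_upwards [(ha.mul_const w).eventually_const_lt (half_lt_self hww),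
    hr.eventually_gt_atTop 1] with n hn hn1
  rw [mul_assoc, inv_mul_eq_div, lt_div_iff₀ (by linarith)] at hn
  rw [← sq_lt_sq]
  nlinarith

lemma dotProduct_self_lt_of_abs_lt {ι : Type*} [Fintype ι] {y z : ι → ℝ} (h : |y| < |z|) :
    y ⬝ᵥ y < z ⬝ᵥ z := by
  obtain ⟨hle, i, hi⟩ := Pi.lt_def.1 h
  exact Finset.sum_lt_sum (fun j _ => abs_le_iff_mul_self_le.1 (hle j))
    ⟨i, Finset.mem_univ i, abs_lt_iff_mul_self_lt.1 hi⟩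

/-- Minimal elements of unbounded norm would accumulate at a direction of `Q` along which they
could still be decreased. -/
lemma exists_forall_exists_abs_le_norm_le {ι : Type*} [Fintype ι]
    (Q : AffineSubspace ℝ (ι → ℝ)) :
    ∃ R : ℝ, ∀ y ∈ Q, ∃ z ∈ Q, |z| ≤ |y| ∧ ‖z‖ ≤ R := by
  by_contra! hunbdd
  have hminimal : ∀ n : ℕ, ∃ z ∈ Q, (n : ℝ) ≤ ‖z‖ ∧
      ∀ z' ∈ Q, |z'| ≤ |z| → z ⬝ᵥ z ≤ z' ⬝ᵥ z' := fun n => by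
    obtain ⟨y, hy, hlarge⟩ := hunbdd n
    obtain ⟨z, hzQ, hzy, hmin⟩ := exists_minimal_abs_le Q hy
    exact ⟨z, hzQ, (hlarge z hzQ hzy).le, hmin⟩
  choose z hzQ hzn hmin using hminimal
  have hinf : Tendsto (fun n => ‖z n‖) atTop atTop :=
    tendsto_atTop_mono hzn tendsto_natCast_atTop_atTop
  obtain ⟨w, hw, hw0, σ, hσ, hlim⟩ := exists_direction_tendsto_inv_norm_smul Q hzQ hinf
  have hdecr : ∀ i, ∀ᶠ n in atTop, w i ≠ 0 → |z (σ n) i - w i| < |z (σ n) i| := by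
    intro i
    by_cases hi : w i = 0
    · exact Eventually.of_forall fun n h => absurd hi h
    · exact (eventually_abs_sub_lt hi (hinf.comp hσ.tendsto_atTop)
        (tendsto_pi_nhds.1 hlim i)).mono fun n hn _ => hn
  obtain ⟨n, hn⟩ := (eventually_all.2 hdecr).exists
  have hmem : z (σ n) - w ∈ Q := by
    rw [sub_eq_neg_add]
    exact AffineSubspace.vadd_mem_of_mem_direction (neg_mem hw) (hzQ _)
  have hlt : |z (σ n) - w| < |z (σ n)| := by
    obtain ⟨i, hi⟩ := Function.ne_iff.1 hw0
    refine Pi.lt_def.2 ⟨fun j => ?_, i, hn i hi⟩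
    by_cases hj : w j = 0
    · simp only [Pi.abs_apply, Pi.sub_apply, hj, sub_zero, le_refl]
    · exact (hn j hj).le
  exact (hmin _ _ hmem hlt.le).not_gt (dotProduct_self_lt_of_abs_lt hlt)

end Domination

section Gaussian

open InformationTheory

lemma integral_exp_mul_gaussianReal (m : ℝ) (v : ℝ≥0) (t : ℝ) :
    ∫ y, Real.exp (t * y) ∂gaussianReal m v = Real.exp (m * t + v * t ^ 2 / 2) :=
  congrFun mgf_id_gaussianReal t

lemma gaussianReal_eq_tilted (m m' : ℝ) {v : ℝ≥0} (hv : v ≠ 0) :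
    gaussianReal m' v = (gaussianReal m v).tilted fun y => (m' - m) / v * y := by
  have hv' : (v : ℝ) ≠ 0 := NNReal.coe_ne_zero.2 hv
  rw [Measure.tilted, integral_exp_mul_gaussianReal, gaussianReal_of_var_ne_zero m hv,
    gaussianReal_of_var_ne_zero m' hv,
    ← withDensity_mul _ (measurable_gaussianPDF m v) (by fun_prop)]
  congr 1
  ext y
  rw [Pi.mul_apply, gaussianPDF, gaussianPDF, ← ENNReal.ofReal_mul (gaussianPDFReal_nonneg _ _ _),
    gaussianPDFReal, gaussianPDFReal, ← Real.exp_sub, mul_assoc _ (Real.exp _) (Real.exp _),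
    ← Real.exp_add]
  congr 3
  field_simp
  ring

lemma toReal_klDiv_gaussianReal (m m' : ℝ) {v : ℝ≥0} (hv : v ≠ 0) :
    (klDiv (gaussianReal m v) (gaussianReal m' v)).toReal = (m' - m) ^ 2 / (2 * v) := by
  have hv' : (v : ℝ) ≠ 0 := NNReal.coe_ne_zero.2 hv
  have hid : Integrable (fun y : ℝ => y) (gaussianReal m v) :=
    memLp_one_iff_integrable.1 (memLp_id_gaussianReal 1)
  rw [gaussianReal_eq_tilted m m' hv,
    toReal_klDiv_tilted (hid.const_mul _) (integrable_exp_mul_gaussianReal _),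
    integral_exp_mul_gaussianReal, Real.log_exp, integral_const_mul, integral_id_gaussianReal]
  field_simp
  ring

end Gaussian

section LinModel

variable {K d : ℕ}

/-- The divergences caused by shifting the mean of each arm `i` by `u i` at variance `v i`. -/
def shiftKL (v : Fin K → ℝ≥0) (u : Fin K → ℝ) (i : Fin K) : ℝ := u i ^ 2 / (2 * v i)

/-- The mean shifts `A (ϑ - θ)` that lead from `θ` to a parameter `ϑ` at which the arms `I` and
`x` tie. -/
def tieShifts (A : Matrix (Fin K) (Fin d) ℝ) (θ : Fin d → ℝ) (I x : Fin K) :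
    AffineSubspace ℝ (Fin K → ℝ) :=
  (AffineSubspace.mk' (-θ) (LinearMap.ker (dotProductBilin ℝ ℝ (A x - A I)))).map
    A.mulVecLin.toAffineMap

variable {A : Matrix (Fin K) (Fin d) ℝ} {v : Fin K → ℝ≥0} {θ ϑ : Fin d → ℝ} {I x : Fin K}

lemma shiftKL_nonneg (v : Fin K → ℝ≥0) (u : Fin K → ℝ) : 0 ≤ shiftKL v u := fun i =>
  div_nonneg (sq_nonneg _) (by positivity)

lemma shiftKL_le_shiftKL (v : Fin K → ℝ≥0) {u u' : Fin K → ℝ} (h : |u| ≤ |u'|) :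
    shiftKL v u ≤ shiftKL v u' := fun i =>
  div_le_div_of_nonneg_right (sq_le_sq.2 (h i)) (by positivity)

lemma continuous_shiftKL (v : Fin K → ℝ≥0) : Continuous (shiftKL v) :=
  continuous_pi fun i => by unfold shiftKL; fun_prop

lemma convexOn_shiftKL (v : Fin K → ℝ≥0) : ConvexOn ℝ Set.univ (shiftKL v) := by
  refine ⟨convex_univ, fun u _ u' _ s t hs ht hst i => ?_⟩
  have hsq := (even_two.convexOn_pow (𝕜 := ℝ)).2 (Set.mem_univ (u i)) (Set.mem_univ (u' i))
    hs ht hst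
  have hdiv := div_le_div_of_nonneg_right hsq (by positivity : (0 : ℝ) ≤ 2 * v i)
  simpa only [shiftKL, Pi.add_apply, Pi.smul_apply, smul_eq_mul, add_div, mul_div_assoc] using hdiv

lemma shiftKL_midpoint_lt {u u' : Fin K → ℝ} {i : Fin K} (hne : shiftKL v u i ≠ shiftKL v u' i) :
    shiftKL v ((1 / 2 : ℝ) • u + (1 / 2 : ℝ) • u') i < (shiftKL v u i + shiftKL v u' i) / 2 := by
  have hv : v i ≠ 0 := fun h => hne (by simp only [shiftKL, h, NNReal.coe_zero, mul_zero, div_zero])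
  have hu : u i - u' i ≠ 0 := fun h => hne (by simp only [shiftKL, sub_eq_zero.1 h])
  have hgap : (shiftKL v u i + shiftKL v u' i) / 2 -
      shiftKL v ((1 / 2 : ℝ) • u + (1 / 2 : ℝ) • u') i = (u i - u' i) ^ 2 / (8 * v i) := by
    simp only [shiftKL, Pi.add_apply, Pi.smul_apply, smul_eq_mul]
    ring
  rw [← sub_pos, hgap]
  exact div_pos (sq_pos_of_ne_zero hu) (by positivity)

lemma armMean_linModel (A : Matrix (Fin K) (Fin d) ℝ) (v : Fin K → ℝ≥0) (ϑ : Fin d → ℝ)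
    (i : Fin K) : armMean (linModel A v) ϑ i = A i ⬝ᵥ ϑ :=
  integral_id_gaussianReal

lemma information_linModel (hv : ∀ i, v i ≠ 0) (θ ϑ : Fin d → ℝ) (p : Fin K → ℝ) :
    information (linModel A v) θ p ϑ = p ⬝ᵥ shiftKL v (A *ᵥ (ϑ - θ)) := by
  refine Finset.sum_congr rfl fun i _ => ?_
  rw [linModel, linModel, toReal_klDiv_gaussianReal _ _ (hv i), shiftKL, Matrix.mulVec,
    dotProduct_sub]

lemma mem_tieShifts {y : Fin K → ℝ} :
    y ∈ tieShifts A θ I x ↔ ∃ ϑ, A x ⬝ᵥ ϑ = A I ⬝ᵥ ϑ ∧ A *ᵥ (ϑ - θ) = y := by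
  simp only [tieShifts, AffineSubspace.mem_map, AffineSubspace.mem_mk', LinearMap.mem_ker,
    LinearMap.coe_toAffineMap, Matrix.mulVecLin_apply, vsub_eq_sub, sub_neg_eq_add,
    dotProductBilin_apply_apply, sub_dotProduct, sub_eq_zero]
  constructor
  · rintro ⟨k, hk, rfl⟩
    exact ⟨k + θ, hk, by rw [add_sub_cancel_right]⟩
  · rintro ⟨ϑ, hϑ, rfl⟩
    exact ⟨ϑ - θ, by rwa [sub_add_cancel], rfl⟩

lemma exists_mem_tieShifts_abs_le (hθ : A x ⬝ᵥ θ < A I ⬝ᵥ θ) (hϑ : A I ⬝ᵥ ϑ < A x ⬝ᵥ ϑ) :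
    ∃ y ∈ tieShifts A θ I x, |y| ≤ |A *ᵥ (ϑ - θ)| := by
  set g := A I ⬝ᵥ θ - A x ⬝ᵥ θ with hg
  set g' := A x ⬝ᵥ ϑ - A I ⬝ᵥ ϑ with hg'
  have hpos : 0 < g := sub_pos.2 hθ
  have hpos' : 0 < g' := sub_pos.2 hϑ
  refine ⟨(g / (g + g')) • A *ᵥ (ϑ - θ), mem_tieShifts.2 ⟨θ + (g / (g + g')) • (ϑ - θ), ?_, ?_⟩,
    fun i => ?_⟩
  · simp only [dotProduct_add, dotProduct_smul, dotProduct_sub, smul_eq_mul]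
    field_simp
    rw [hg, hg']
    ring
  · rw [add_sub_cancel_left, Matrix.mulVec_smul]
  · rw [Pi.abs_apply, Pi.abs_apply, Pi.smul_apply, smul_eq_mul, abs_mul,
      abs_of_pos (by positivity)]
    exact mul_le_of_le_one_left (abs_nonneg _)
      ((div_le_one (by positivity)).2 (le_add_of_nonneg_right hpos'.le))

/-- The witness overshoots the tie on the ray from `θ`. -/
lemma exists_information_lt_shiftKL_add (hv : ∀ i, v i ≠ 0) (hθ : A x ⬝ᵥ θ < A I ⬝ᵥ θ)
    (p : Fin K → ℝ) {y : Fin K → ℝ} (hy : y ∈ tieShifts A θ I x) {ε : ℝ} (hε : 0 < ε) :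
    ∃ ϑ ∈ altSet (linModel A v) Set.univ I x,
      information (linModel A v) θ p ϑ < p ⬝ᵥ shiftKL v y + ε := by
  obtain ⟨ϑ, htie, rfl⟩ := mem_tieShifts.1 hy
  have hcont : Continuous fun s : ℝ => p ⬝ᵥ shiftKL v (s • A *ᵥ (ϑ - θ)) :=
    (by fun_prop : Continuous fun f : Fin K → ℝ => p ⬝ᵥ f).comp
      ((continuous_shiftKL v).comp (by fun_prop))
  have hlim := hcont.tendsto 1
  rw [one_smul] at hlim
  obtain ⟨s, hsε, hs : 1 < s⟩ := (((hlim.eventually_lt_const (lt_add_of_pos_right _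
    hε)).filter_mono nhdsWithin_le_nhds).and (self_mem_nhdsWithin (s := Set.Ioi 1))).exists
  refine ⟨θ + s • (ϑ - θ), ⟨Set.mem_univ _, ?_⟩, ?_⟩
  · simp only [armMean_linModel, dotProduct_add, dotProduct_smul, dotProduct_sub, htie,
      smul_eq_mul]
    nlinarith
  · rwa [information_linModel hv, add_sub_cancel_left, Matrix.mulVec_smul]

theorem exists_isScenario_linModel (hv : ∀ i, v i ≠ 0) (hθ : A x ⬝ᵥ θ < A I ⬝ᵥ θ) :
    ∃ U, IsScenario U (shiftKL v) (fun p => scenarioPayoff (linModel A v) Set.univ θ I p x) := by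
  obtain ⟨R, hR⟩ := exists_forall_exists_abs_le_norm_le (tieShifts A θ I x)
  have hne : ((tieShifts A θ I x : Set (Fin K → ℝ)) ∩ Metric.closedBall 0 R).Nonempty := by
    obtain ⟨z, hz, -, hzR⟩ := hR _ (mem_tieShifts.2 ⟨0, by simp only [dotProduct_zero], rfl⟩)
    exact ⟨z, hz, mem_closedBall_zero_iff.2 hzR⟩
  refine ⟨(tieShifts A θ I x : Set (Fin K → ℝ)) ∩ Metric.closedBall 0 R,
    { isCompact := (isCompact_closedBall 0 R).inter_left
        (tieShifts A θ I x).closed_of_finiteDimensional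
      nonempty := hne
      continuousOn_cost := (continuous_shiftKL v).continuousOn
      cost_nonneg := fun u _ => shiftKL_nonneg v u
      convexOn := (convexOn_shiftKL v).subset (Set.subset_univ _)
        ((tieShifts A θ I x).convex.inter (convex_closedBall 0 R))
      midpoint_lt := fun u _ u' _ i => shiftKL_midpoint_lt
      eq_sInf := fun p hp => sInf_image_eq_sInf_image hne
        (fun u _ => dotProduct_nonneg_of_nonneg hp (shiftKL_nonneg v u)) ?_
        (fun y hy ε hε => exists_information_lt_shiftKL_add hv hθ p hy.1 hε) }⟩
  rintro ϑ ⟨-, hϑ⟩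
  rw [armMean_linModel, armMean_linModel] at hϑ
  obtain ⟨y, hy, hyle⟩ := exists_mem_tieShifts_abs_le hθ hϑ
  obtain ⟨z, hz, hzle, hzR⟩ := hR y hy
  refine ⟨z, ⟨hz, mem_closedBall_zero_iff.2 hzR⟩, ?_⟩
  rw [information_linModel hv]
  exact dotProduct_le_dotProduct_of_nonneg_left (shiftKL_le_shiftKL v (hzle.trans hyle)) hp

end LinModel

lemma nonempty_other_arms {K : ℕ} (hK : 2 ≤ K) (I : Fin K) : Nonempty {x : Fin K // x ≠ I} :=
  have : Nontrivial (Fin K) := Fin.nontrivial_iff_two_le.2 hK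
  nonempty_subtype.2 (exists_ne I)

end FWSP

end

theorem theorem1 :
    (∀ (K : ℕ) (_ : 2 ≤ K) (ν : Measure ℝ) (θ : Fin K → ℝ) (I : Fin K)
      (_ : θ ∈ FWSP.expParams ν K) (_ : FWSP.IsUniqueBestArm (FWSP.expModel ν K) θ I),
      ∃ Fstar : ℝ,
        FWSP.IsGameValue (FWSP.payoff (FWSP.expModel ν K) (FWSP.expParams ν K) θ I) Fstar ∧
        ∀ (p : ℕ → Fin K → ℝ) (μ : ℕ → {x : Fin K // x ≠ I} → ℝ),
          FWSP.IsTrajectory (FWSP.payoff (FWSP.expModel ν K) (FWSP.expParams ν K) θ I) p μ →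
          Tendsto (fun n => FWSP.payoff (FWSP.expModel ν K) (FWSP.expParams ν K) θ I (p n) (μ n))
            atTop (𝓝 Fstar)) ∧
    (∀ (K : ℕ) (_ : 2 ≤ K) (d : ℕ) (A : Matrix (Fin K) (Fin d) ℝ) (v : Fin K → ℝ≥0)
      (_ : ∀ i, v i ≠ 0) (θ : Fin d → ℝ) (I : Fin K)
      (_ : FWSP.IsUniqueBestArm (FWSP.linModel A v) θ I),
      ∃ Fstar : ℝ,
        FWSP.IsGameValue (FWSP.payoff (FWSP.linModel A v) Set.univ θ I) Fstar ∧
        ∀ (p : ℕ → Fin K → ℝ) (μ : ℕ → {x : Fin K // x ≠ I} → ℝ),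
          FWSP.IsTrajectory (FWSP.payoff (FWSP.linModel A v) Set.univ θ I) p μ →
          Tendsto (fun n => FWSP.payoff (FWSP.linModel A v) Set.univ θ I (p n) (μ n))
            atTop (𝓝 Fstar)) := by
  refine ⟨fun K hK ν θ I hθ hI => ?_, fun K hK d A v hv θ I hI => ?_⟩
  all_goals
    have : Nonempty {x // x ≠ I} := FWSP.nonempty_other_arms hK I
    have : Nonempty (Fin K) := ⟨I⟩
  · have hlt : ∀ x, x ≠ I → θ x < θ I := fun x hx => by
      simpa only [FWSP.armMean_expModel (hθ _)] using hI x hx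
    exact FWSP.exists_isGameValue_and_tendsto fun x : {x // x ≠ I} =>
      FWSP.isScenario_expModel hθ (hlt x x.2)
  · have hlt : ∀ x, x ≠ I → A x ⬝ᵥ θ < A I ⬝ᵥ θ := fun x hx => by
      simpa only [FWSP.armMean_linModel] using hI x hx
    choose U hU using fun x : {x // x ≠ I} => FWSP.exists_isScenario_linModel hv (hlt x x.2)
    exact FWSP.exists_isGameValue_and_tendsto hU
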